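/- Let $m\ge 1$ and $k\ge 2$ be integers with $$1^k+2^k+\cdots+(m-1)^k=m^k.$$ Then: 1) $m>1.485\cdot 10^{9321155}$. 2) $k$ is even, $m\equiv 3 \pmod 8$ and $m\equiv \pm 1\pmod 3$. 3) The integers $m-1$, $(m+1)/2$, $2m-1$ and $2m+1$ are all square-free. 4) If a prime $p$ divides at least one of the integers in 3), then $p-1$ divides $k$. 5) The number $(m^2-1)(4m^2-1)/12$ is a square-free integer and has at least $4990906$ (distinct) prime factors. -/

import Mathlib

/-!
Moser's method. Reducing the equation modulo a prime divisor `p` of one of the integers `n = m - 1`,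
`(m + 1) / 2`, `2 m - 1`, `2 m + 1`, where the sum of the `k`-th powers becomes a multiple of a
complete power sum modulo `p`, gives `p - 1 ∣ k` and `p ∣ n / p + c` with `c = 1, 1, 2, 4`
(`dvd_div_add_of_sum_eq`). Hence these integers are squarefree, and each of the sums
`∑_{p ∣ n} 1/p + c/n` is a positive integer (`one_sub_le_primeRecipSum`). The four integers have in
common only the primes `2` and `3`, each of which divides exactly two of them, so that the prime
factors of the squarefree integer `M = (m² - 1) (4 m² - 1) / 12` satisfy
`∑ 1/p ≥ 4 - 1/2 - 1/3 - O(1/m)` (`ErdosMoser.twelve_dvd_and_squarefree`). The facts `2 ∤ m` and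
`3 ∤ m` come from the `p`-adic valuation of the power sum (`not_pow_dvd_sum_range_pow`).

A set of primes with such a reciprocal sum has at least `4990906` elements, because the sum over the
first `4990905` primes is smaller than `19/6` by about `7.9 · 10⁻⁹`. The product of the elements is
then at least the product of the first `4990906` primes, and it is at most `m⁴ / 3`. The two estimates
follow from upper bounds for `∑_{p < z} (1/p - 1/z)` and `∑_{p < z} log (z / p)`, in which all terms are
nonnegative (`PrimeBounds.sum_one_div_le`, `PrimeBounds.le_sum_log`), at a point `z` slightly above
the 4990906th prime.

These bounds are computed in the kernel. The odd numbers of a long interval are represented by the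
bits of one numeral, and a sieve by small moduli clears the bits of composite numbers. Word-parallel
arithmetic on that numeral yields, for each short block of numbers, the number of survivors and the
first two moments of their positions in the block, and second order Taylor expansions of `1/x` and
`log x` turn the moments into bounds for the sums (`PrimeBounds.block`, `PrimeBounds.segment`). It is
only necessary to prove that no prime is ever removed by the sieve.
-/

/-! ### Logarithm bounds -/

theorem Real.sub_sq_div_two_le_log_one_add {x : ℝ} (hx : 0 ≤ x) : x - x ^ 2 / 2 ≤ Real.log (1 + x) := by
  refine le_trans ?_ (Real.le_log_one_add_of_nonneg hx)
  rw [le_div_iff₀ (by positivity)]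
  nlinarith [pow_nonneg hx 3]

theorem Real.log_one_add_le_cubic {x : ℝ} (hx : 0 ≤ x) :
    Real.log (1 + x) ≤ x - x ^ 2 / 2 + x ^ 3 / 3 := by
  let f : ℝ → ℝ := fun t => t - t ^ 2 / 2 + t ^ 3 / 3 - Real.log (1 + t)
  have hd : ∀ t ∈ Set.Ici (0 : ℝ), HasDerivAt f (t ^ 3 / (1 + t)) t := by
    intro t ht
    have h0 : (1 + t : ℝ) ≠ 0 := by have : (0 : ℝ) ≤ t := ht; positivity
    have h1 : HasDerivAt (fun t : ℝ => Real.log (1 + t)) (1 / (1 + t)) t :=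
      ((hasDerivAt_id t).const_add 1).log h0
    have h2 := (((hasDerivAt_id t).sub (((hasDerivAt_id t).pow 2).div_const 2)).add
      (((hasDerivAt_id t).pow 3).div_const 3)).sub h1
    refine h2.congr_deriv ?_
    simp only [id]
    field_simp
    push_cast
    ring
  have hm : MonotoneOn f (Set.Ici 0) := by
    refine monotoneOn_of_deriv_nonneg (convex_Ici 0)
      (fun t ht => (hd t ht).continuousAt.continuousWithinAt)
      (fun t ht => (hd t (interior_subset ht)).differentiableAt.differentiableWithinAt) ?_
    intro t ht
    have ht0 : (0 : ℝ) ≤ t := interior_subset ht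
    rw [(hd t ht0).deriv]
    positivity
  have h := hm (Set.self_mem_Ici) hx hx
  simp only [f] at h
  norm_num at h
  linarith

/-! ### Cumulative bounds for sums over the primes -/

/-- There is a set `T` of positive integers below the odd number `z` that contains all the primes
below `z`, has exactly `N` elements, and satisfies `∑ 1/n ≤ R / 2^64` and
`∑ log (z / n) ≤ F / 2^64`. Both summands are nonnegative, so that a set which is larger than the
set of primes still gives valid (if weaker) upper bounds for the primes. -/
def PrimeBounds (z N R F : ℕ) : Prop :=
  Odd z ∧ 1 < z ∧ ∃ T : Finset ℕ, (∀ p, p.Prime → p < z → p ∈ T) ∧ (∀ n ∈ T, 0 < n ∧ n < z) ∧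
    T.card = N ∧ (∑ n ∈ T, (1 / n : ℝ)) * 2 ^ 64 ≤ R ∧
    (∑ n ∈ T, Real.log (z / n)) * 2 ^ 64 ≤ F

theorem PrimeBounds.mono {z N R F R' F' : ℕ} (h : PrimeBounds z N R F) (hR : R ≤ R')
    (hF : F ≤ F') : PrimeBounds z N R' F' := by
  obtain ⟨hz, hz1, T, h1, h2, h3, h4, h5⟩ := h
  exact ⟨hz, hz1, T, h1, h2, h3, h4.trans (by exact_mod_cast hR), h5.trans (by exact_mod_cast hF)⟩

theorem le_natDiv_add_one {a b : ℕ} {x : ℝ} (hb : 0 < b) (h : x * b ≤ a) :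
    x ≤ ((a / b + 1 : ℕ) : ℝ) := by
  have h1 : a < (a / b + 1) * b := by
    have := Nat.lt_div_mul_add (a := a) hb
    linarith
  have h2 : (a : ℝ) ≤ ((a / b + 1 : ℕ) : ℝ) * b := by exact_mod_cast h1.le
  exact le_of_mul_le_mul_right (h.trans h2) (by exact_mod_cast hb)

theorem Nat.cast_sub_le_cast_tsub (a b : ℕ) : (a : ℝ) - b ≤ ((a - b : ℕ) : ℝ) := by
  have : a ≤ (a - b) + b := by omega
  have h : (a : ℝ) ≤ ((a - b : ℕ) : ℝ) + b := by exact_mod_cast this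
  linarith

/-- One block of the sieve: `x i ∈ {0, 1}` marks the survivors among the `w` odd numbers
`z + 2 i`, and `c`, `s`, `t` are the zeroth, first and second moments of the mark. The bounds come
from `1/(z + u) ≤ 1/z - u/z² + u²/z³` and `-log (1 + u/z) ≤ -u/z + u²/(2 z²)` with `u = 2 i`, and, for
the change of the end point, from the cubic upper bound for `log (1 + 2 w/z)`. The subtractions may
truncate, which only enlarges the result. -/
theorem PrimeBounds.block {z N R F : ℕ} (h : PrimeBounds z N R F) (w : ℕ) (x : ℕ → ℕ)
    (hx : ∀ i, x i ≤ 1) (hp : ∀ i < w, (z + 2 * i).Prime → x i = 1) {c s t : ℕ}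
    (hc : c = ∑ i ∈ Finset.range w, x i) (hs : s = ∑ i ∈ Finset.range w, i * x i)
    (ht : t = ∑ i ∈ Finset.range w, i * i * x i) :
    PrimeBounds (z + 2 * w) (N + c)
      (R + ((c * (z * z) + 4 * t - 2 * (s * z)) * 2 ^ 64 / (z * z * z) + 1))
      (F + (((N + c) * (6 * (2 * w) * (z * z) + 2 * (2 * w * (2 * w * (2 * w))))
        + 12 * (t * z) - ((N + c) * (3 * (2 * w * (2 * w) * z)) + 12 * (s * (z * z)))) * 2 ^ 64 /
          (6 * (z * z * z)) + 1)) := by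
  obtain ⟨hz, hz1, T, h1, h2, h3, h4, h5⟩ := h
  have hz0 : 0 < z := hz.pos
  have hzR : (0 : ℝ) < z := by exact_mod_cast hz0
  let U := ((Finset.range w).filter (fun i => x i = 1)).image (fun i => z + 2 * i)
  have hinj : Function.Injective (fun i : ℕ => z + 2 * i) := fun a b hab => by
    simp only at hab; omega
  have hdisj : Disjoint T U := by
    rw [Finset.disjoint_left]
    intro n hn hn'
    simp only [U, Finset.mem_image] at hn'
    obtain ⟨i, -, rfl⟩ := hn'
    have := (h2 _ hn).2
    omega
  have hsumU : ∀ f : ℕ → ℝ, ∑ n ∈ U, f n = ∑ i ∈ Finset.range w, x i * f (z + 2 * i) := by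
    intro f
    rw [Finset.sum_image (fun a _ b _ hab => hinj hab), Finset.sum_filter]
    refine Finset.sum_congr rfl fun i _ => ?_
    have := hx i
    interval_cases hxi : x i <;> simp
  have hcard : U.card = c := by
    have := hsumU (fun _ => 1)
    simp only [Finset.sum_const, nsmul_eq_mul, mul_one] at this
    rw [hc]
    exact_mod_cast this
  have hcR : (c : ℝ) = ∑ i ∈ Finset.range w, (x i : ℝ) := by rw [hc]; push_cast; rfl
  have hsR : (s : ℝ) = ∑ i ∈ Finset.range w, (i : ℝ) * x i := by rw [hs]; push_cast; rfl
  have htR : (t : ℝ) = ∑ i ∈ Finset.range w, (i : ℝ) * i * x i := by rw [ht]; push_cast; rfl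
  refine ⟨hz.add_even (even_two_mul w), by omega, T ∪ U, ?_, ?_, ?_, ?_, ?_⟩
  · intro p hpp hpz
    rw [Finset.mem_union]
    rcases lt_or_ge p z with hlt | hge
    · exact Or.inl (h1 p hpp hlt)
    · right
      have hodd : Odd p := hpp.odd_of_ne_two (by obtain ⟨r, hr⟩ := hz; omega)
      obtain ⟨a, ha⟩ := hodd
      obtain ⟨r, hr⟩ := hz
      have hpe : p = z + 2 * (a - r) := by omega
      simp only [U, Finset.mem_image, Finset.mem_filter, Finset.mem_range]
      refine ⟨a - r, ⟨by omega, hp _ (by omega) (hpe ▸ hpp)⟩, hpe.symm⟩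
  · intro n hn
    rcases Finset.mem_union.mp hn with hn | hn
    · have := h2 n hn; omega
    · simp only [U, Finset.mem_image, Finset.mem_filter, Finset.mem_range] at hn
      obtain ⟨i, ⟨hi, -⟩, rfl⟩ := hn
      omega
  · rw [Finset.card_union_of_disjoint hdisj, hcard, h3]
  · rw [Finset.sum_union hdisj, add_mul, hsumU (fun n => 1 / (n : ℝ))]
    rw [Nat.cast_add]
    refine add_le_add h4 (le_natDiv_add_one (by positivity) ?_)
    have hkey : (∑ i ∈ Finset.range w, (x i : ℝ) * (1 / ((z + 2 * i : ℕ) : ℝ))) * (z * z * z : ℕ)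
        ≤ c * (z * z) + 4 * t - 2 * (s * z) := by
      rw [hcR, hsR, htR, Finset.sum_mul, Finset.sum_mul, Finset.mul_sum, Finset.sum_mul,
        Finset.mul_sum, ← Finset.sum_add_distrib, ← Finset.sum_sub_distrib]
      refine Finset.sum_le_sum fun i _ => ?_
      have hi : (0 : ℝ) ≤ i := Nat.cast_nonneg i
      have e : (1 / ((z + 2 * i : ℕ) : ℝ)) * (z * z * z : ℕ) ≤ z * z + 4 * (i * i) - 2 * (i * z) := by
        push_cast
        rw [div_mul_eq_mul_div, one_mul, div_le_iff₀ (by positivity)]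
        have : (0 : ℝ) ≤ i * i * i := by positivity
        nlinarith
      calc _ = (x i : ℝ) * (1 / ((z + 2 * i : ℕ) : ℝ) * (z * z * z : ℕ)) := by ring
        _ ≤ (x i : ℝ) * (z * z + 4 * (i * i) - 2 * (i * z)) :=
          mul_le_mul_of_nonneg_left e (Nat.cast_nonneg _)
        _ = _ := by ring
    have h6 := Nat.cast_sub_le_cast_tsub (c * (z * z) + 4 * t) (2 * (s * z))
    push_cast at h6 hkey ⊢
    nlinarith
  · rw [Finset.sum_union hdisj, hsumU (fun n => Real.log ((z + 2 * w : ℕ) / (n : ℝ)))]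
    rw [Nat.cast_add F]
    have hT : ∑ n ∈ T, Real.log ((z + 2 * w : ℕ) / (n : ℝ)) =
        ∑ n ∈ T, Real.log (z / n) + N * Real.log (1 + 2 * w / z) := by
      rw [← h3, ← nsmul_eq_mul, ← Finset.sum_const, ← Finset.sum_add_distrib]
      refine Finset.sum_congr rfl fun n hn => ?_
      have : (0 : ℝ) < n := by exact_mod_cast (h2 n hn).1
      rw [← Real.log_mul (by positivity) (by positivity)]
      congr 1
      push_cast
      field_simp
    have hU : ∑ i ∈ Finset.range w, x i * Real.log ((z + 2 * w : ℕ) / ((z + 2 * i : ℕ) : ℝ)) ≤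
        c * Real.log (1 + 2 * w / z) - 2 * s / z + 2 * t / z ^ 2 := by
      rw [hcR, hsR, htR, Finset.sum_mul, Finset.mul_sum, Finset.mul_sum, Finset.sum_div,
        Finset.sum_div, ← Finset.sum_sub_distrib, ← Finset.sum_add_distrib]
      refine Finset.sum_le_sum fun i _ => ?_
      have hi : (0 : ℝ) ≤ i := Nat.cast_nonneg i
      have e : Real.log ((z + 2 * w : ℕ) / ((z + 2 * i : ℕ) : ℝ)) ≤
          Real.log (1 + 2 * w / z) - 2 * i / z + 2 * (i * i) / z ^ 2 := by
        have e1 : ((z + 2 * w : ℕ) : ℝ) / ((z + 2 * i : ℕ) : ℝ) =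
            (1 + 2 * w / z) / (1 + 2 * i / z) := by
          push_cast
          field_simp
        rw [e1, Real.log_div (by positivity) (by positivity)]
        have := Real.sub_sq_div_two_le_log_one_add (x := 2 * i / z) (by positivity)
        have e2 : (2 * (i : ℝ) / z) ^ 2 / 2 = 2 * (i * i) / z ^ 2 := by ring
        linarith
      calc _ ≤ (x i : ℝ) * (Real.log (1 + 2 * w / z) - 2 * i / z + 2 * (i * i) / z ^ 2) :=
          mul_le_mul_of_nonneg_left e (Nat.cast_nonneg _)
        _ = _ := by ring
    have hl := Real.log_one_add_le_cubic (x := 2 * w / z) (by positivity)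
    rw [hT, add_assoc, add_mul]
    refine add_le_add h5 (le_natDiv_add_one (by positivity) ?_)
    have hA : N * Real.log (1 + 2 * w / z) +
        ∑ i ∈ Finset.range w, x i * Real.log ((z + 2 * w : ℕ) / ((z + 2 * i : ℕ) : ℝ)) ≤
        (N + c) * (2 * w / z - (2 * w / z) ^ 2 / 2 + (2 * w / z) ^ 3 / 3) - 2 * s / z
          + 2 * t / z ^ 2 := by
      have : ((N : ℝ) + c) * Real.log (1 + 2 * w / z) ≤ (N + c) *
        (2 * w / z - (2 * w / z) ^ 2 / 2 + (2 * w / z) ^ 3 / 3) :=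
        mul_le_mul_of_nonneg_left hl (by positivity)
      linarith
    have h6 := Nat.cast_sub_le_cast_tsub ((N + c) * (6 * (2 * w) * (z * z)
        + 2 * (2 * w * (2 * w * (2 * w)))) + 12 * (t * z))
        ((N + c) * (3 * (2 * w * (2 * w) * z)) + 12 * (s * (z * z)))
    have hB := mul_le_mul_of_nonneg_right hA (show (0 : ℝ) ≤ 6 * (z * z * z) by positivity)
    have e3 : (((N : ℝ) + c) * (2 * w / z - (2 * w / z) ^ 2 / 2 + (2 * w / z) ^ 3 / 3) - 2 * s / z
          + 2 * t / z ^ 2) * (6 * (z * z * z)) = ((N + c) * (6 * (2 * w) * (z * z)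
        + 2 * (2 * w * (2 * w * (2 * w)))) + 12 * (t * z)) -
        ((N + c) * (3 * (2 * w * (2 * w) * z)) + 12 * (s * (z * z))) := by
      field_simp
      ring
    rw [e3] at hB
    push_cast at h6 hB ⊢
    nlinarith

/-! ### Packed vectors of natural numbers -/

/-- The natural number whose base-`2^w` digits are `x 0, …, x (n - 1)` (provided that these are
smaller than `2^w`). -/
def pack (w n : ℕ) (x : ℕ → ℕ) : ℕ := ∑ j ∈ Finset.range n, x j * 2 ^ (w * j)

theorem pack_zero (w : ℕ) (x : ℕ → ℕ) : pack w 0 x = 0 := rfl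

theorem pack_succ (w n : ℕ) (x : ℕ → ℕ) :
    pack w (n + 1) x = 2 ^ w * pack w n (fun j => x (j + 1)) + x 0 := by
  simp only [pack, Finset.sum_range_succ', Finset.mul_sum]
  congr 1
  · refine Finset.sum_congr rfl fun j _ => ?_
    ring
  · simp

theorem pack_congr {w n : ℕ} {x y : ℕ → ℕ} (h : ∀ j < n, x j = y j) : pack w n x = pack w n y :=
  Finset.sum_congr rfl fun j hj => by rw [h j (Finset.mem_range.mp hj)]

theorem pack_add (w n : ℕ) (x y : ℕ → ℕ) :
    pack w n x + pack w n y = pack w n (fun j => x j + y j) := by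
  simp only [pack, ← Finset.sum_add_distrib, add_mul]

theorem mul_pack (w n a : ℕ) (x : ℕ → ℕ) : a * pack w n x = pack w n (fun j => a * x j) := by
  simp only [pack, Finset.mul_sum, mul_assoc]

theorem pack_zero_fun (w n : ℕ) : pack w n (fun _ => 0) = 0 := by simp [pack]

theorem pack_two_mul (w n : ℕ) (x : ℕ → ℕ) :
    pack w (n * 2) x = pack (2 * w) n (fun j => x (2 * j) + 2 ^ w * x (2 * j + 1)) := by
  induction n generalizing x with
  | zero => rfl
  | succ n ih =>
    rw [Nat.succ_mul, pack_succ, pack_succ, pack_succ, ih]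
    simp only [show ∀ j, 2 * j + 1 + 1 = 2 * (j + 1) from fun j => by ring, mul_zero, zero_add]
    ring

/-- The numeral that selects the even-indexed fields of width `w` of a number of `2 w n` bits. -/
theorem evenMask_eq (w n : ℕ) :
    (2 ^ (n * 2 * w) - 1) / (2 ^ w + 1) = pack (2 * w) n (fun _ => 2 ^ w - 1) := by
  apply Nat.div_eq_of_eq_mul_left (by positivity)
  induction n with
  | zero => simp [pack_zero]
  | succ n ih =>
    have e := congrArg (2 ^ (2 * w) * ·) ih
    rw [pack_succ, add_mul (2 ^ (2 * w) * _), mul_assoc (2 ^ (2 * w)), ← e]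
    have h1 : 1 ≤ 2 ^ w := Nat.one_le_two_pow
    have h2 : 1 ≤ 2 ^ (n * 2 * w) := Nat.one_le_two_pow
    have h3 : 1 ≤ 2 ^ ((n + 1) * 2 * w) := Nat.one_le_two_pow
    zify [h1, h2, h3]
    ring

theorem two_pow_mul_add_land {k a b : ℕ} (ha : a < 2 ^ k) (hb : b < 2 ^ k) (X Y : ℕ) :
    (2 ^ k * X + a) &&& (2 ^ k * Y + b) = 2 ^ k * (X &&& Y) + (a &&& b) := by
  apply Nat.eq_of_testBit_eq
  intro i
  rw [Nat.testBit_and, Nat.testBit_two_pow_mul_add _ ha, Nat.testBit_two_pow_mul_add _ hb,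
    Nat.testBit_two_pow_mul_add _ (lt_of_le_of_lt Nat.and_le_left ha)]
  split <;> simp

theorem pack_land_evenMask (w n : ℕ) (x : ℕ → ℕ) (hx : ∀ j, x j < 2 ^ w) :
    pack w (n * 2) x &&& (2 ^ (n * 2 * w) - 1) / (2 ^ w + 1) =
      pack (2 * w) n (fun j => x (2 * j)) := by
  rw [evenMask_eq, pack_two_mul]
  induction n generalizing x with
  | zero => simp [pack_zero]
  | succ n ih =>
    have h1 : 1 ≤ 2 ^ w := Nat.one_le_two_pow
    have h0 := hx (2 * 0)
    have h0' := hx (2 * 0 + 1)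
    have hpow : 2 ^ (2 * w) = 2 ^ w * 2 ^ w := by rw [two_mul, pow_add]
    rw [pack_succ, pack_succ, pack_succ, two_pow_mul_add_land]
    · congr 1
      · congr 1
        exact ih (fun j => x (j + 2)) (fun j => hx _)
      · rw [Nat.and_two_pow_sub_one_eq_mod, Nat.add_mul_mod_self_left, Nat.mod_eq_of_lt h0]
    · rw [hpow]; nlinarith
    · rw [hpow]; nlinarith [Nat.sub_lt h1 one_pos]

theorem pack_sub_even_shiftRight (w n : ℕ) (x : ℕ → ℕ) :
    (pack w (n * 2) x - pack (2 * w) n (fun j => x (2 * j))) >>> w =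
      pack (2 * w) n (fun j => x (2 * j + 1)) := by
  rw [pack_two_mul, ← pack_add, ← mul_pack, Nat.add_sub_cancel_left, Nat.shiftRight_eq_div_pow,
    Nat.mul_div_cancel_left _ (by positivity)]

theorem pack_testBit {L B : ℕ} (h : B < 2 ^ L) :
    pack 1 L (fun i => (B.testBit i).toNat) = B := by
  induction L generalizing B with
  | zero => simp at h; simp [h, pack_zero]
  | succ L ih =>
    rw [pack_succ]
    simp only [Nat.testBit_add_one]
    rw [ih (B := B / 2) (by rw [pow_succ] at h; omega), Nat.testBit_zero]
    rcases Nat.mod_two_eq_zero_or_one B with h2 | h2 <;> simp [h2] <;> omega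

/-! ### Moments of the blocks of a `0`-`1` sequence -/

/-- The `r`-th moment of the `b`-th block of length `w` of the sequence `x`. -/
def blockMoment (x : ℕ → ℕ) (r w b : ℕ) : ℕ := ∑ i ∈ Finset.range w, i ^ r * x (b * w + i)

theorem blockMoment_lt {x : ℕ → ℕ} (hx : ∀ i, x i ≤ 1) {r : ℕ} (hr : r ≤ 2) (w b : ℕ) :
    blockMoment x r w b < 2 ^ w := by
  have h1 : blockMoment x r w b ≤ ∑ i ∈ Finset.range w, i ^ r := by
    refine Finset.sum_le_sum fun i _ => ?_
    have := Nat.mul_le_mul_left (i ^ r) (hx (b * w + i))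
    rwa [mul_one] at this
  refine h1.trans_lt ?_
  clear h1
  have h4 : ∀ n : ℕ, 4 ≤ n → n ^ 2 ≤ 2 ^ n := by
    intro n hn
    induction n, hn using Nat.le_induction with
    | base => norm_num
    | succ n hn ih => rw [pow_succ 2 n]; nlinarith
  have hstep : ∀ n : ℕ, ∑ i ∈ Finset.range (n + 4), i ^ r < 2 ^ (n + 4) := by
    intro n
    induction n with
    | zero => interval_cases r <;> decide
    | succ n ih =>
      rw [show n + 1 + 4 = (n + 4) + 1 by ring, Finset.sum_range_succ, pow_succ]
      have h5 := h4 (n + 4) (by omega)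
      have h6 : (n + 4) ^ r ≤ (n + 4) ^ 2 := Nat.pow_le_pow_right (by omega) hr
      omega
  rcases lt_or_ge w 4 with hw | hw
  · interval_cases w <;> interval_cases r <;> decide
  · obtain ⟨n, rfl⟩ := Nat.exists_eq_add_of_le' hw
    exact hstep n

theorem blockMoment_zero_two_mul (x : ℕ → ℕ) (w b : ℕ) :
    blockMoment x 0 (2 * w) b = blockMoment x 0 w (2 * b) + blockMoment x 0 w (2 * b + 1) := by
  simp only [blockMoment, two_mul w, Finset.sum_range_add, pow_zero, one_mul]
  congr 1 <;> exact Finset.sum_congr rfl fun i _ => by congr 1; ring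

theorem blockMoment_one_two_mul (x : ℕ → ℕ) (w b : ℕ) :
    blockMoment x 1 (2 * w) b = blockMoment x 1 w (2 * b) + blockMoment x 1 w (2 * b + 1) +
      w * blockMoment x 0 w (2 * b + 1) := by
  simp only [blockMoment, two_mul w, Finset.sum_range_add, pow_zero, one_mul, pow_one, add_assoc,
    Finset.mul_sum, ← Finset.sum_add_distrib]
  refine Finset.sum_congr rfl fun i _ => ?_
  rw [show b * (w + w) + (w + i) = (2 * b + 1) * w + i by ring,
    show b * (w + w) + i = 2 * b * w + i by ring]
  ring

theorem blockMoment_two_two_mul (x : ℕ → ℕ) (w b : ℕ) :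
    blockMoment x 2 (2 * w) b = blockMoment x 2 w (2 * b) + blockMoment x 2 w (2 * b + 1) +
      (2 * w * blockMoment x 1 w (2 * b + 1) + w * w * blockMoment x 0 w (2 * b + 1)) := by
  simp only [blockMoment, two_mul w, Finset.sum_range_add, pow_zero, one_mul, pow_one, add_assoc,
    Finset.mul_sum, ← Finset.sum_add_distrib]
  refine Finset.sum_congr rfl fun i _ => ?_
  rw [show b * (w + w) + (w + i) = (2 * b + 1) * w + i by ring,
    show b * (w + w) + i = 2 * b * w + i by ring]
  ring

/-! ### The sieve as a kernel computation

The functions of this part are evaluated by the kernel, which has fast arithmetic for the primitive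
operations `Nat.add`, `Nat.lor`, `Nat.shiftLeft`, … on numerals. For that reason they are
written with these primitives in place of the overloaded notation, and with recursors in place of
structural recursion. -/

/-- `force x k = k x`. The detour through `Nat.ble 0 x` makes the kernel evaluate `x` to a numeral
at once, so that unevaluated terms do not pile up in the loops below. -/
noncomputable def force {α : Type} (x : ℕ) (k : ℕ → α) : α :=
  @Bool.rec (fun _ => α) (k 0) (k x) (Nat.ble 0 x)

theorem force_eq {α : Type} (x : ℕ) (k : ℕ → α) : force x k = k x := by
  cases x <;> rfl

/-- Periodic extension of the bit pattern `X` with period `s` to at least `L` bits, by repeated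
doubling. -/
noncomputable def extendPeriodic (L fuel : ℕ) : ℕ → ℕ → ℕ :=
  @Nat.rec (fun _ => ℕ → ℕ → ℕ) (fun _ X => X)
    (fun _ ih s X => @Bool.rec (fun _ => ℕ)
      (force (Nat.lor X (Nat.shiftLeft X s)) (ih (Nat.mul 2 s))) X (Nat.ble L s)) fuel

theorem dvd_of_testBit_extendPeriodic {q z L : ℕ} (fuel : ℕ) {s X : ℕ} (hs : q ∣ s)
    (hX : ∀ i, X.testBit i → q ∣ z + 2 * i) {i : ℕ}
    (hi : (extendPeriodic L fuel s X).testBit i) : q ∣ z + 2 * i := by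
  induction fuel generalizing s X with
  | zero => exact hX i hi
  | succ f ih =>
    change (@Bool.rec (fun _ => ℕ) (force (X ||| (X <<< s)) (extendPeriodic L f (2 * s))) X
      (Nat.ble L s)).testBit i = true at hi
    cases h : Nat.ble L s
    · simp only [h, force_eq] at hi
      refine ih (hs.mul_left 2) (fun j hj => ?_) hi
      rw [Nat.testBit_or, Bool.or_eq_true, Nat.testBit_shiftLeft] at hj
      rcases hj with hj | hj
      · exact hX j hj
      · simp only [Bool.and_eq_true, decide_eq_true_eq] at hj
        have h1 := hX _ hj.2
        have h2 : z + 2 * j = (z + 2 * (j - s)) + 2 * s := by omega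
        rw [h2]
        exact h1.add (hs.mul_left 2)
    · simp only [h] at hi
      exact hX i hi

/-- The product of the primes below `100`. -/
def primorial97 : ℕ := 2305567963945518424753102147331756070

/-- Mark (in the bits of `acc`) the indices `i` for which `z + 2 i` is a multiple of one of the
moduli `q = 2 n' + 3` with `n' < n`. The moduli above `97` that have a prime factor below `100` are
skipped, as their multiples are marked anyway. An unmarked composite number would not affect the
validity of the bounds. -/
noncomputable def sieve (z L n : ℕ) : ℕ → ℕ :=
  @Nat.rec (fun _ => ℕ → ℕ) (fun acc => acc)
    (fun n ih acc =>
      force (Nat.add (Nat.mul 2 n) 3) fun q =>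
      @Bool.rec (fun _ => ℕ) (ih acc)
        (force (Nat.lor acc (extendPeriodic L 30 q (Nat.shiftLeft 1
          (Nat.mod (Nat.mul (Nat.sub q (Nat.mod z q)) (Nat.add n 2)) q)))) ih)
        (@Bool.rec (fun _ => Bool) (Nat.ble q 97) true (Nat.ble (Nat.gcd q primorial97) 1))) n

/-- As `n + 2` is the inverse of `2` modulo `2 n + 3`, this is the first index at which `2 n + 3`
divides `z + 2 i`. -/
theorem dvd_add_two_mul_sieve_offset (z n : ℕ) :
    (2 * n + 3) ∣ z + 2 * ((2 * n + 3 - z % (2 * n + 3)) * (n + 2) % (2 * n + 3)) := by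
  have hlt : z % (2 * n + 3) < 2 * n + 3 := Nat.mod_lt _ (by omega)
  obtain ⟨d, hd⟩ := Nat.exists_eq_add_of_le hlt.le
  rw [show 2 * n + 3 - z % (2 * n + 3) = d by omega, ← Nat.modEq_zero_iff_dvd]
  calc z + 2 * (d * (n + 2) % (2 * n + 3))
      ≡ z % (2 * n + 3) + 2 * (d * (n + 2)) [MOD 2 * n + 3] :=
        (Nat.mod_modEq _ _).symm.add ((Nat.mod_modEq _ _).mul_left 2)
    _ = (2 * n + 3) * (d + 1) := by linarith
    _ ≡ 0 [MOD 2 * n + 3] := (Nat.modEq_zero_iff_dvd).mpr (dvd_mul_right _ _)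

theorem not_prime_of_testBit_sieve {z L n acc : ℕ} (hn : 2 * n + 1 < z)
    (hacc : ∀ i, acc.testBit i → ¬ (z + 2 * i).Prime) {i : ℕ}
    (hi : (sieve z L n acc).testBit i) : ¬ (z + 2 * i).Prime := by
  induction n generalizing acc with
  | zero => exact hacc i hi
  | succ n ih =>
    change (force (2 * n + 3) fun q => @Bool.rec (fun _ => ℕ) (sieve z L n acc)
        (force (acc ||| (extendPeriodic L 30 q (1 <<< ((q - z % q) * (n + 2) % q))))
          (sieve z L n))
        (@Bool.rec (fun _ => Bool) (Nat.ble q 97) true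
          (Nat.ble (Nat.gcd q primorial97) 1))).testBit i = true at hi
    rw [force_eq] at hi
    generalize (@Bool.rec (fun _ => Bool) (Nat.ble (2 * n + 3) 97) true
          (Nat.ble (Nat.gcd (2 * n + 3) primorial97) 1)) = b at hi
    cases b
    · exact ih (by omega) hacc hi
    · simp only [force_eq] at hi
      refine ih (by omega) (fun j hj => ?_) hi
      rw [Nat.testBit_or, Bool.or_eq_true] at hj
      rcases hj with hj | hj
      · exact hacc j hj
      · have hdvd : 2 * n + 3 ∣ z + 2 * j := by
          refine dvd_of_testBit_extendPeriodic 30 dvd_rfl (fun l hl => ?_) hj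
          rw [Nat.one_shiftLeft, Nat.testBit_two_pow] at hl
          rw [← of_decide_eq_true hl]
          exact dvd_add_two_mul_sieve_offset z n
        intro hp
        rcases (Nat.dvd_prime hp).mp hdvd with h | h <;> omega

/-- Starting from the vectors `C`, `S`, `T` of the moments of the blocks of length `w`, packed into
fields of `w` bits, pass to blocks of length `2^J w` by merging adjacent blocks `J` times. The
numeral `full` is a string of ones that spans all fields. -/
noncomputable def mergeBlocks {α : Type} (full : ℕ) (k : ℕ → ℕ → ℕ → ℕ → α) (J : ℕ) :
    ℕ → ℕ → ℕ → ℕ → α :=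
  @Nat.rec (fun _ => ℕ → ℕ → ℕ → ℕ → α) k
   (fun _ ih w C S T =>
     force (Nat.div full (Nat.succ (Nat.pow 2 w))) fun M =>
     force (Nat.land C M) fun Ce =>
     force (Nat.land S M) fun Se =>
     force (Nat.land T M) fun Te =>
     force (Nat.shiftRight (Nat.sub C Ce) w) fun Co =>
     force (Nat.shiftRight (Nat.sub S Se) w) fun So =>
     force (Nat.shiftRight (Nat.sub T Te) w) fun To =>
     force (Nat.mul 2 w) fun w2 =>
     force (Nat.add Ce Co) fun C' =>
     force (Nat.add (Nat.add Se So) (Nat.mul w Co)) fun S' =>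
     force (Nat.add (Nat.add Te To) (Nat.add (Nat.mul w2 So) (Nat.mul (Nat.mul w w) Co)))
       fun T' => ih w2 C' S' T') J

/-- All moments of blocks of length `w` fit into `w` bits (`blockMoment_lt`), so that no field
overflows. -/
theorem mergeBlocks_eq {α : Type} (k : ℕ → ℕ → ℕ → ℕ → α) {x : ℕ → ℕ} (hx : ∀ i, x i ≤ 1)
    (J n w : ℕ) :
    mergeBlocks (2 ^ (n * 2 ^ J * w) - 1) k J w (pack w (n * 2 ^ J) (blockMoment x 0 w))
      (pack w (n * 2 ^ J) (blockMoment x 1 w)) (pack w (n * 2 ^ J) (blockMoment x 2 w)) =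
    k (2 ^ J * w) (pack (2 ^ J * w) n (blockMoment x 0 (2 ^ J * w)))
      (pack (2 ^ J * w) n (blockMoment x 1 (2 ^ J * w)))
      (pack (2 ^ J * w) n (blockMoment x 2 (2 ^ J * w))) := by
  induction J generalizing w with
  | zero => simp [mergeBlocks]
  | succ J ih =>
    have hstep : ∀ full C S T, mergeBlocks full k (J + 1) w C S T =
        force (full / (2 ^ w + 1)) fun M =>
        force (C &&& M) fun Ce =>
        force (S &&& M) fun Se =>
        force (T &&& M) fun Te =>
        force ((C - Ce) >>> w) fun Co =>
        force ((S - Se) >>> w) fun So =>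
        force ((T - Te) >>> w) fun To =>
        force (2 * w) fun w2 =>
        force (Ce + Co) fun C' =>
        force (Se + So + w * Co) fun S' =>
        force (Te + To + (w2 * So + w * w * Co)) fun T' =>
        mergeBlocks full k J w2 C' S' T' := fun _ _ _ _ => rfl
    have e1 : n * 2 ^ (J + 1) = n * 2 ^ J * 2 := by ring
    have e2 : n * 2 ^ J * 2 * w = n * 2 ^ J * (2 * w) := by ring
    have e3 : 2 ^ (J + 1) * w = 2 ^ J * (2 * w) := by ring
    rw [hstep, e1]
    simp only [force_eq]
    rw [pack_land_evenMask _ _ _ (blockMoment_lt hx (by norm_num) w),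
      pack_land_evenMask _ _ _ (blockMoment_lt hx (by norm_num) w),
      pack_land_evenMask _ _ _ (blockMoment_lt hx (by norm_num) w)]
    simp only [pack_sub_even_shiftRight, mul_pack, pack_add]
    simp only [← blockMoment_zero_two_mul, ← blockMoment_one_two_mul, ← blockMoment_two_two_mul]
    rw [e2, e3]
    exact ih (2 * w)

/-- Run through `nb` blocks of length `w`, whose moments are packed in `C`, `S`, `T`, and update
`z`, `N`, `R`, `F` as in `PrimeBounds.block`. The numeral `18446744073709551616` is `2^64`. -/
noncomputable def sumBlocks {α : Type} (w : ℕ) (k : ℕ → ℕ → ℕ → α) (nb : ℕ) :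
    ℕ → ℕ → ℕ → ℕ → ℕ → ℕ → ℕ → α :=
  @Nat.rec (fun _ => ℕ → ℕ → ℕ → ℕ → ℕ → ℕ → ℕ → α) (fun _ _ _ _ N R F => k N R F)
   (fun _ ih z C S T N R F =>
     force (Nat.pow 2 w) fun m =>
     force (Nat.mod C m) fun c =>
     force (Nat.mod S m) fun s =>
     force (Nat.mod T m) fun t =>
     force (Nat.shiftRight C w) fun C' =>
     force (Nat.shiftRight S w) fun S' =>
     force (Nat.shiftRight T w) fun T' =>
     force (Nat.mul z z) fun zz =>
     force (Nat.mul zz z) fun zzz =>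
     force (Nat.mul 2 w) fun W =>
     force (Nat.add N c) fun N' =>
     force (Nat.add R (Nat.succ (Nat.div (Nat.mul (Nat.sub (Nat.add (Nat.mul c zz) (Nat.mul 4 t))
       (Nat.mul 2 (Nat.mul s z))) 18446744073709551616) zzz))) fun R' =>
     force (Nat.add F (Nat.succ (Nat.div (Nat.mul
        (Nat.sub (Nat.add (Nat.mul N' (Nat.add (Nat.mul (Nat.mul 6 W) zz)
          (Nat.mul 2 (Nat.mul W (Nat.mul W W))))) (Nat.mul 12 (Nat.mul t z)))
          (Nat.add (Nat.mul N' (Nat.mul 3 (Nat.mul (Nat.mul W W) z)))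
            (Nat.mul 12 (Nat.mul s zz)))) 18446744073709551616) (Nat.mul 6 zzz)))) fun F' =>
     force (Nat.add z W) fun z' =>
     ih z' C' S' T' N' R' F') nb

theorem exists_sumBlocks_eq {α : Type} (w : ℕ) (k : ℕ → ℕ → ℕ → α) (nb : ℕ) {z N R F : ℕ}
    {x : ℕ → ℕ} (hx : ∀ i, x i ≤ 1) (hp : ∀ i < nb * w, (z + 2 * i).Prime → x i = 1)
    (h : PrimeBounds z N R F) :
    ∃ N' R' F', sumBlocks w k nb z (pack w nb (blockMoment x 0 w)) (pack w nb (blockMoment x 1 w))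
      (pack w nb (blockMoment x 2 w)) N R F = k N' R' F' ∧
      PrimeBounds (z + 2 * (nb * w)) N' R' F' := by
  induction nb generalizing z N R F x with
  | zero => exact ⟨N, R, F, rfl, by simpa using h⟩
  | succ nb ih =>
    have hstep : ∀ C S T, sumBlocks w k (nb + 1) z C S T N R F =
        force (2 ^ w) fun m =>
        force (C % m) fun c =>
        force (S % m) fun s =>
        force (T % m) fun t =>
        force (C >>> w) fun C' =>
        force (S >>> w) fun S' =>
        force (T >>> w) fun T' =>
        force (z * z) fun zz =>
        force (zz * z) fun zzz =>
        force (2 * w) fun W =>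
        force (N + c) fun N' =>
        force (R + ((c * zz + 4 * t - 2 * (s * z)) * 18446744073709551616 / zzz + 1)) fun R' =>
        force (F + ((N' * (6 * W * zz + 2 * (W * (W * W))) + 12 * (t * z) -
          (N' * (3 * (W * W * z)) + 12 * (s * zz))) * 18446744073709551616 / (6 * zzz) + 1))
            fun F' =>
        force (z + W) fun z' =>
        sumBlocks w k nb z' C' S' T' N' R' F' := fun _ _ _ => rfl
    have hmod : ∀ r ≤ 2, pack w (nb + 1) (blockMoment x r w) % 2 ^ w = blockMoment x r w 0 := by
      intro r hr
      rw [pack_succ, Nat.mul_add_mod, Nat.mod_eq_of_lt (blockMoment_lt hx hr w 0)]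
    have hshift : ∀ r ≤ 2, pack w (nb + 1) (blockMoment x r w) >>> w =
        pack w nb (blockMoment (fun i => x (i + w)) r w) := by
      intro r hr
      rw [pack_succ, Nat.shiftRight_eq_div_pow, Nat.mul_add_div (by positivity),
        Nat.div_eq_of_lt (blockMoment_lt hx hr w 0), add_zero]
      refine pack_congr fun j _ => Finset.sum_congr rfl fun i _ => ?_
      rw [show (j + 1) * w + i = j * w + i + w by ring]
    have h' := h.block w x hx (fun i hi => hp i (by nlinarith))
      (c := blockMoment x 0 w 0) (s := blockMoment x 1 w 0) (t := blockMoment x 2 w 0)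
      (by simp [blockMoment]) (by simp [blockMoment]) (by simp [blockMoment, sq])
    obtain ⟨N', R', F', h1, h2⟩ := ih (x := fun i => x (i + w)) (fun i => hx _)
      (fun i hi hpr => hp (i + w) (by nlinarith) (by convert hpr using 1; ring)) h'
    refine ⟨N', R', F', ?_, by convert h2 using 1; ring⟩
    rw [hstep]
    simp only [force_eq]
    rw [hmod 0 (by norm_num), hmod 1 (by norm_num), hmod 2 le_rfl, hshift 0 (by norm_num),
      hshift 1 (by norm_num), hshift 2 le_rfl]
    exact h1

/-- Sieve the `nb * 2^J` odd numbers from `z` on by the odd moduli up to `2 n + 1`, and check that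
the bounds `N`, `R`, `F` at `z` lead to the bounds `N₁`, `R₁`, `F₁` at `z₁ = z + 2 nb 2^J`. -/
noncomputable def checkSegment (z J nb n N R F z₁ N₁ R₁ F₁ : ℕ) : Bool :=
  (Nat.ble (Nat.add (Nat.mul 2 n) 2) z).and <|
  force (Nat.mul nb (Nat.pow 2 J)) fun L =>
  force (Nat.sub (Nat.pow 2 L) 1) fun full =>
  force (sieve z L n 0) fun acc =>
  force (Nat.xor full (Nat.land full acc)) fun B =>
  mergeBlocks full (fun w C S T => sumBlocks w (fun N' R' F' =>
    (Nat.beq (Nat.add z (Nat.mul 2 L)) z₁).and <|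
      (Nat.beq N' N₁).and <| (Nat.ble R' R₁).and (Nat.ble F' F₁)) nb z C S T N R F) J 1 B 0 0

theorem PrimeBounds.segment {z N R F : ℕ} (h : PrimeBounds z N R F) (J nb n z₁ N₁ R₁ F₁ : ℕ)
    (hc : checkSegment z J nb n N R F z₁ N₁ R₁ F₁ = true) : PrimeBounds z₁ N₁ R₁ F₁ := by
  set L := nb * 2 ^ J with hL
  set full := 2 ^ L - 1 with hfull
  set acc := sieve z L n 0 with hacc
  set B := full ^^^ (full &&& acc) with hB
  have hBit : ∀ i, B.testBit i = (decide (i < L) && !acc.testBit i) := by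
    intro i
    rw [hB, Nat.testBit_xor, Nat.testBit_and, hfull, Nat.testBit_two_pow_sub_one]
    cases decide (i < L) <;> simp
  have hBlt : B < 2 ^ L := by
    refine Nat.lt_pow_two_of_testBit _ fun i hi => ?_
    rw [hBit]
    simp [not_lt.mpr hi]
  set x : ℕ → ℕ := fun i => (B.testBit i).toNat with hxdef
  have hx : ∀ i, x i ≤ 1 := fun i => Bool.toNat_le _
  have hc' : mergeBlocks full (fun w C S T => sumBlocks w (fun N' R' F' =>
    (Nat.beq (z + 2 * L) z₁).and <|
      (Nat.beq N' N₁).and <| (Nat.ble R' R₁).and (Nat.ble F' F₁)) nb z C S T N R F) J 1 B 0 0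
      = true ∧ 2 * n + 1 < z := by
    have : checkSegment z J nb n N R F z₁ N₁ R₁ F₁ = ((Nat.ble (2 * n + 2) z).and <|
      force L fun L => force (2 ^ L - 1) fun full =>
      force (sieve z L n 0) fun acc => force (full ^^^ (full &&& acc)) fun B =>
      mergeBlocks full (fun w C S T => sumBlocks w (fun N' R' F' =>
      (Nat.beq (z + 2 * L) z₁).and <|
        (Nat.beq N' N₁).and <| (Nat.ble R' R₁).and (Nat.ble F' F₁)) nb z C S T N R F) J 1 B 0 0) :=
      rfl
    rw [this, Bool.and_eq_true, Nat.ble_eq] at hc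
    simp only [force_eq] at hc
    exact ⟨hc.2, hc.1⟩
  obtain ⟨hc', hguard⟩ := hc'
  have hM : ∀ r, r ≠ 0 → pack 1 (nb * 2 ^ J) (blockMoment x r 1) = 0 := by
    intro r hr
    rw [← pack_zero_fun 1 (nb * 2 ^ J)]
    exact pack_congr fun j _ => by simp [blockMoment, hr]
  have hM0 : pack 1 (nb * 2 ^ J) (blockMoment x 0 1) = B := by
    rw [← pack_testBit hBlt]
    exact pack_congr fun j _ => by simp [blockMoment, x]
  have hmerge := fun k : ℕ → ℕ → ℕ → ℕ → Bool => mergeBlocks_eq k hx J nb 1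
  simp only [hM0, hM 1 one_ne_zero, hM 2 two_ne_zero, mul_one] at hmerge
  rw [hfull, hmerge] at hc'
  have hp : ∀ i < nb * 2 ^ J, (z + 2 * i).Prime → x i = 1 := by
    intro i hi hpr
    have : acc.testBit i = false := by
      by_contra hcon
      exact not_prime_of_testBit_sieve (L := L) (acc := 0) hguard
        (fun j hj => absurd hj (by simp [Nat.zero_testBit])) (by simpa using hcon) hpr
    simp only [hxdef, hBit, this]
    simp [hL, hi]
  obtain ⟨N', R', F', h1, h2⟩ := exists_sumBlocks_eq (2 ^ J) (fun N' R' F' =>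
      (Nat.beq (z + 2 * L) z₁).and <|
        (Nat.beq N' N₁).and <| (Nat.ble R' R₁).and (Nat.ble F' F₁)) nb hx hp h
  rw [h1] at hc'
  simp only [Bool.and_eq_true, Nat.ble_eq, Nat.beq_eq] at hc'
  obtain ⟨hz, hN, hR, hF⟩ := hc'
  rw [← hz, ← hN]
  exact h2.mono hR hF

/-! ### Bounds at the start of the sieve -/

/-- The bounds over the primes below `129`. The logarithm of `∏ 129/p` is estimated by comparing its
power with the exponent `237` to `2^13246`; this fraction is a good approximation from above to
the binary logarithm. -/
theorem primeBounds_129 : PrimeBounds 129 31 34267974290119391065 714630610274542397441 := by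
  refine ⟨by decide, by norm_num, {2, 3, 5, 7, 11, 13, 17, 19, 23, 29, 31, 37, 41, 43, 47, 53, 59, 61, 67,
    71, 73, 79, 83, 89, 97, 101, 103, 107, 109, 113, 127}, ?_, ?_, by decide, ?_, ?_⟩
  · intro p hp hlt
    by_contra hmem
    interval_cases p <;> first | (exact hmem (by decide)) | (revert hp; norm_num)
  · decide
  · norm_num
  · rw [← Real.log_prod (fun n hn => ?_)]
    · norm_num only [Finset.prod_insert, Finset.prod_singleton, Finset.mem_insert,
        Finset.mem_singleton, not_false_eq_true]
      have key : ∀ a b : ℕ, 0 < a → 0 < b → a ^ 237 ≤ 2 ^ 13246 * b ^ 237 →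
          Real.log (a / b) * 2 ^ 64 ≤ 714630610274542397441 := by
        intro a b ha hb h
        have ha' : (0 : ℝ) < a := by exact_mod_cast ha
        have hb' : (0 : ℝ) < b := by exact_mod_cast hb
        have h0 : (a : ℝ) ^ 237 ≤ 2 ^ 13246 * b ^ 237 := by exact_mod_cast h
        have h1 := Real.log_le_log (by positivity) h0
        rw [Real.log_mul (by positivity) (by positivity), Real.log_pow, Real.log_pow,
          Real.log_pow] at h1
        have h2 := Real.log_two_lt_d9
        rw [Real.log_div ha'.ne' hb'.ne']
        norm_num at h1 ⊢
        linarith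
      have := key (129 ^ 31) 4014476939333036189094441199026045136645885247730
        (by norm_num) (by norm_num) (by decide +kernel)
      norm_num at this ⊢
      exact this
    · fin_cases hn <;> norm_num

/-! ### The primes below `85862401` -/

/-- The sieve, in 92 segments. The arguments of `PrimeBounds.segment` are `J`, `nb`, `n`, `z₁`, `N₁`,
`R₁`, `F₁`. The blocks have `2^J` odd numbers, short in comparison with `z`, so that the Taylor
expansions in the blocks are accurate enough; `n` is such that `2 n + 1` exceeds the square root of `z₁`. The
end `85862401` lies just above the 4990906th prime, which is `85861889`. -/
theorem primeBounds_85862401 :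
    PrimeBounds 85862401 4990931 58414695015953696818 98213060969695135776228775 := by
  have h := primeBounds_129
  replace h := h.segment 0 448 17 1025 172
    40620083898819102169 3845100101254199752930 (by decide +kernel)
  replace h := h.segment 0 512 23 2049 309
    42342977762438965351 6837303241228776650952 (by decide +kernel)
  replace h := h.segment 1 512 33 4097 564
    43941013417591569262 12247732590364018362384 (by decide +kernel)
  replace h := h.segment 2 512 46 8193 1028
    45395312675770108520 22121438861754662422070 (by decide +kernel)
  replace h := h.segment 3 512 65 16385 1900
    46761990243586314738 40264501145055324485807 (by decide +kernel)
  replace h := h.segment 4 512 91 32769 3512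
    48024560073717042714 73791957357788614596611 (by decide +kernel)
  replace h := h.segment 5 512 129 65537 6542
    49212666082433733192 136117408643673727420427 (by decide +kernel)
  replace h := h.segment 6 512 182 131073 12251
    50330611758085898132 252456620039552268492362 (by decide +kernel)
  replace h := h.segment 7 512 257 262145 23000
    51382839774003376049 470628420650622336750027 (by decide +kernel)
  replace h := h.segment 8 512 363 524289 43390
    52380417849719083019 881242214086999515265945 (by decide +kernel)
  replace h := h.segment 9 512 513 1048577 82025
    53325347638176343408 1656757976578430421688330 (by decide +kernel)
  replace h := h.segment 10 512 725 2097153 155611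
    54225187547721792024 3125847328687611396280543 (by decide +kernel)
  replace h := h.segment 11 256 887 3145729 226549
    54731666078292992743 4538379141252117993437425 (by decide +kernel)
  replace h := h.segment 11 256 1025 4194305 295947
    55083065034307175195 5916593014729817587999750 (by decide +kernel)
  replace h := h.segment 11 256 1145 5242881 364195
    55351033856453000340 7270300307441108546822014 (by decide +kernel)
  replace h := h.segment 11 256 1255 6291457 431502
    55566948594338009349 8605103171141637585196837 (by decide +kernel)
  replace h := h.segment 11 256 1355 7340033 498177
    55747780131369319684 9924608166427484807968766 (by decide +kernel)
  replace h := h.segment 11 256 1449 8388609 564163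
    55902800795308575039 11231285331894598023758800 (by decide +kernel)
  replace h := h.segment 11 256 1537 9437185 629686
    56038584072186655693 12526973527224402027638411 (by decide +kernel)
  replace h := h.segment 11 256 1620 10485761 694716
    56159123404575844628 13812936975568855929943580 (by decide +kernel)
  replace h := h.segment 11 256 1699 11534337 759401
    56267590288024194335 15090415374395317085289808 (by decide +kernel)
  replace h := h.segment 11 256 1774 12582913 823749
    56366096810557831119 16360298109660079156743935 (by decide +kernel)
  replace h := h.segment 11 256 1847 13631489 887642
    56456072331743224783 17623205945348226493474895 (by decide +kernel)
  replace h := h.segment 11 256 1916 14680065 951351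
    56539135700501548169 18879731445289874634679641 (by decide +kernel)
  replace h := h.segment 11 256 1983 15728641 1014733
    56616065900231214451 20130397337494411787634714 (by decide +kernel)
  replace h := h.segment 11 256 2049 16777217 1077871
    56687751847349026700 21375653865528907842170513 (by decide +kernel)
  replace h := h.segment 11 256 2112 17825793 1140879
    56754953592454416440 22615984735585426022660172 (by decide +kernel)
  replace h := h.segment 11 256 2173 18874369 1203569
    56817991129772326164 23851649704923781960757283 (by decide +kernel)
  replace h := h.segment 11 256 2232 19922945 1266011
    56877382600463740772 25082886971424135748239819 (by decide +kernel)
  replace h := h.segment 11 256 2290 20971521 1328230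
    56933528272108236788 26309997328216621719996628 (by decide +kernel)
  replace h := h.segment 11 256 2347 22020097 1390439
    56986924162501255683 27533204008847709769173421 (by decide +kernel)
  replace h := h.segment 11 256 2402 23068673 1452313
    57037559300917329623 28752700121936724294545617 (by decide +kernel)
  replace h := h.segment 11 256 2456 24117249 1514022
    57085816172231366378 29968700505398128551131957 (by decide +kernel)
  replace h := h.segment 11 256 2509 25165825 1575661
    57131967908353104902 31181401983130634592031578 (by decide +kernel)
  replace h := h.segment 11 256 2561 26214401 1637054
    57176056477888184491 32390867063169531793827809 (by decide +kernel)
  replace h := h.segment 11 256 2611 27262977 1698416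
    57218395579481737874 33597336908529100597814314 (by decide +kernel)
  replace h := h.segment 11 256 2661 28311553 1759651
    57259051197186614580 34800919951616467130672384 (by decide +kernel)
  replace h := h.segment 11 256 2710 29360129 1820645
    57298073747045967049 36001726064150571086336772 (by decide +kernel)
  replace h := h.segment 11 256 2758 30408705 1881720
    57335775907346413873 37199875695249321143109921 (by decide +kernel)
  replace h := h.segment 11 256 2805 31457281 1942384
    57371956489894754785 38395527993090475787889389 (by decide +kernel)
  replace h := h.segment 11 256 2851 32505857 2003091
    57406974690223792025 39588658594195900898787455 (by decide +kernel)
  replace h := h.segment 11 256 2897 33554433 2063689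
    57440820524746413964 40779443233303046843160042 (by decide +kernel)
  replace h := h.segment 11 256 2942 34603009 2123972
    57473454450100292470 41967900376545162115845381 (by decide +kernel)
  replace h := h.segment 11 256 2986 35651585 2184255
    57505113214535525891 43154045706573951786197404 (by decide +kernel)
  replace h := h.segment 11 256 3030 36700161 2244481
    57535825912597312830 44338054634266168634734721 (by decide +kernel)
  replace h := h.segment 11 256 3073 37748737 2304655
    57565647085720737683 45519974350540123302880781 (by decide +kernel)
  replace h := h.segment 11 256 3115 38797313 2364789
    57594631661558511842 46699906018082943695437536 (by decide +kernel)
  replace h := h.segment 11 256 3157 39845889 2424907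
    57622836373878534226 47877974786345926018523774 (by decide +kernel)
  replace h := h.segment 11 256 3198 40894465 2484775
    57650193676521297695 49054169429421027558179899 (by decide +kernel)
  replace h := h.segment 11 256 3239 41943041 2544401
    57676750977049454942 50228507507331249453341786 (by decide +kernel)
  replace h := h.segment 11 256 3279 42991617 2604053
    57702664169053486213 51401030643658672340808667 (by decide +kernel)
  replace h := h.segment 11 256 3319 44040193 2663655
    57727931225425648972 52571784557276572309468440 (by decide +kernel)
  replace h := h.segment 11 256 3358 45088769 2723262
    57752605429039114990 53740846532539564638119387 (by decide +kernel)
  replace h := h.segment 11 256 3397 46137345 2782805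
    57776687152061153746 54908327637596606482836394 (by decide +kernel)
  replace h := h.segment 11 256 3435 47185921 2842191
    57800165192917653165 56074204713416519601558838 (by decide +kernel)
  replace h := h.segment 11 256 3473 48234497 2901307
    57823023163017612854 57238497536832582055499992 (by decide +kernel)
  replace h := h.segment 11 256 3511 49283073 2960538
    57845432748068583929 58401212287336083963666669 (by decide +kernel)
  replace h := h.segment 11 256 3548 50331649 3019815
    57867387804147272639 59562472655680741104631636 (by decide +kernel)
  replace h := h.segment 11 256 3585 51380225 3078902
    57888820925846358619 60722284167129647404153163 (by decide +kernel)
  replace h := h.segment 11 256 3621 52428801 3137912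
    57909793868035401913 61880681108138385531130754 (by decide +kernel)
  replace h := h.segment 11 256 3657 53477377 3196877
    57930335743653285556 63037683724823784253685558 (by decide +kernel)
  replace h := h.segment 11 256 3693 54525953 3255602
    57950396663115573630 64193294141711190666089592 (by decide +kernel)
  replace h := h.segment 11 256 3728 55574529 3314407
    57970102394014486938 65347548583582706079593502 (by decide +kernel)
  replace h := h.segment 11 256 3763 56623105 3373243
    57989450066376685657 66500515186302179606797922 (by decide +kernel)
  replace h := h.segment 11 256 3798 57671681 3432079
    58008442703977983201 67652240370262062634327215 (by decide +kernel)
  replace h := h.segment 11 256 3832 58720257 3490654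
    58027009890948077035 68802697860186692117846623 (by decide +kernel)
  replace h := h.segment 11 256 3866 59768833 3549187
    58045235712499395463 69951931179119124907737137 (by decide +kernel)
  replace h := h.segment 11 256 3900 60817409 3607791
    58063166064216512131 71099955038028321096081328 (by decide +kernel)
  replace h := h.segment 11 256 3933 61865985 3666133
    58080711256360115150 72246801837312004149307783 (by decide +kernel)
  replace h := h.segment 11 256 3966 62914561 3724578
    58097991939807031728 73392473131862353457873255 (by decide +kernel)
  replace h := h.segment 11 256 3999 63963137 3783040
    58114991675492026216 74537014790712539675062947 (by decide +kernel)
  replace h := h.segment 11 256 4032 65011713 3841195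
    58131627500288612626 75680457213596965267655437 (by decide +kernel)
  replace h := h.segment 11 256 4064 66060289 3899509
    58148041643210788415 76822775779837078974058003 (by decide +kernel)
  replace h := h.segment 11 256 4097 67108865 3957809
    58164193701758441489 77964062773335782012491340 (by decide +kernel)
  replace h := h.segment 11 256 4128 68157441 4016043
    58180077275625191818 79104316083861186289902607 (by decide +kernel)
  replace h := h.segment 11 256 4160 69206017 4074043
    58195655446985103681 80243525385789237245033800 (by decide +kernel)
  replace h := h.segment 11 256 4191 70254593 4132158
    58211029850374614097 81381713840610243541234626 (by decide +kernel)
  replace h := h.segment 11 256 4223 71303169 4190151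
    58226144625933752141 82518901850199147219474210 (by decide +kernel)
  replace h := h.segment 11 256 4253 72351745 4248269
    58241070666880657554 83655110008057486028702201 (by decide +kernel)
  replace h := h.segment 11 256 4284 73400321 4306139
    58255719224644261750 84790367264077978350735085 (by decide +kernel)
  replace h := h.segment 11 256 4315 74448897 4363944
    58270143822645384139 85924658604533470464162683 (by decide +kernel)
  replace h := h.segment 11 256 4345 75497473 4421818
    58284383483169349180 87057995682094390364233410 (by decide +kernel)
  replace h := h.segment 11 256 4375 76546049 4479580
    58298399836376235432 88190433146490003880754617 (by decide +kernel)
  replace h := h.segment 11 256 4405 77594625 4537276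
    58312209471549175399 89321935375872866105687327 (by decide +kernel)
  replace h := h.segment 11 256 4435 78643201 4594833
    58325801026066648397 90452527122125890044359480 (by decide +kernel)
  replace h := h.segment 11 256 4464 79691777 4652488
    58339235404727892798 91582220016323545909595864 (by decide +kernel)
  replace h := h.segment 11 256 4493 80740353 4710061
    58352475237949461730 92711032782803304688367809 (by decide +kernel)
  replace h := h.segment 11 256 4522 81788929 4767804
    58365583084110041164 93839025512093119711675707 (by decide +kernel)
  replace h := h.segment 11 256 4551 82837505 4825378
    58378485792846118601 94966175309698974398584415 (by decide +kernel)
  replace h := h.segment 11 256 4580 83886081 4882806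
    58391193854335167576 96092486249487922660533959 (by decide +kernel)
  replace h := h.segment 11 256 4609 84934657 4940115
    58403718245457606082 97217969028007128513216749 (by decide +kernel)
  replace h := h.segment 9 906 4634 85862401 4990931
    58414695015953696818 98213060969695135776228775 (by decide +kernel)
  exact h

/-! ### Consequences for sets of primes -/

/-- If `f` is nonnegative below `z` and nonpositive from `z` on, then the sum of `f` over any finite set
of primes is at most the sum over the set `T` of `PrimeBounds`. -/
theorem PrimeBounds.sum_le_sum {z N R F : ℕ} (h : PrimeBounds z N R F) :
    ∃ T : Finset ℕ, T.card = N ∧ (∑ n ∈ T, (1 / n : ℝ)) * 2 ^ 64 ≤ R ∧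
      (∑ n ∈ T, Real.log (z / n)) * 2 ^ 64 ≤ F ∧
      ∀ S : Finset ℕ, (∀ p ∈ S, p.Prime) → ∀ f : ℕ → ℝ, (∀ n, 0 < n → n < z → 0 ≤ f n) →
        (∀ n, z ≤ n → f n ≤ 0) → ∑ p ∈ S, f p ≤ ∑ n ∈ T, f n := by
  obtain ⟨-, -, T, h1, h2, h3, h4, h5⟩ := h
  refine ⟨T, h3, h4, h5, fun S hS f hf hf' => ?_⟩
  calc ∑ p ∈ S, f p ≤ ∑ p ∈ S with p < z, f p := by
        rw [← Finset.sum_filter_add_sum_filter_not S (fun p => p < z)]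
        have : ∑ p ∈ S with ¬ p < z, f p ≤ 0 := Finset.sum_nonpos fun p hp =>
          hf' p (not_lt.mp (Finset.mem_filter.mp hp).2)
        linarith
    _ ≤ ∑ n ∈ T, f n := by
        refine Finset.sum_le_sum_of_subset_of_nonneg (fun p hp => ?_)
          (fun n hn _ => hf n (h2 n hn).1 (h2 n hn).2)
        rw [Finset.mem_filter] at hp
        exact h1 p (hS p hp.1) hp.2

/-- A bound for the reciprocal sum of a set of primes by its cardinality; it is close to an equality
for an initial segment of the primes that ends near `z`. -/
theorem PrimeBounds.sum_one_div_le {z N R F : ℕ} (h : PrimeBounds z N R F) {S : Finset ℕ}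
    (hS : ∀ p ∈ S, p.Prime) :
    ∑ p ∈ S, (1 / p : ℝ) ≤ R / 2 ^ 64 + ((S.card : ℝ) - N) / z := by
  have hz : (0 : ℝ) < z := by
    have := h.2.1
    exact_mod_cast (by omega : 0 < z)
  obtain ⟨T, h3, h4, -, hT⟩ := h.sum_le_sum
  have := hT S hS (fun n => 1 / n - 1 / z)
    (fun n hn hlt => sub_nonneg.mpr (one_div_le_one_div_of_le (by exact_mod_cast hn)
      (by exact_mod_cast hlt.le)))
    (fun n hn => sub_nonpos.mpr (one_div_le_one_div_of_le hz (by exact_mod_cast hn)))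
  simp only [Finset.sum_sub_distrib, Finset.sum_const, nsmul_eq_mul, h3] at this
  rw [← le_div_iff₀ (by positivity)] at h4
  have e : ((S.card : ℝ) - N) / z = S.card * (1 / z) - N * (1 / z) := by ring
  linarith

/-- A bound for the logarithm of the product of a set of primes by its cardinality; it is close to an
equality for an initial segment of the primes that ends near `z`. -/
theorem PrimeBounds.le_sum_log {z N R F : ℕ} (h : PrimeBounds z N R F) {S : Finset ℕ}
    (hS : ∀ p ∈ S, p.Prime) :
    S.card * Real.log z - F / 2 ^ 64 ≤ ∑ p ∈ S, Real.log p := by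
  have hz : (0 : ℝ) < z := by
    have := h.2.1
    exact_mod_cast (by omega : 0 < z)
  obtain ⟨T, h3, -, h5, hT⟩ := h.sum_le_sum
  have := hT S hS (fun n => Real.log (z / n))
    (fun n hn hlt => Real.log_nonneg ((one_le_div (by exact_mod_cast hn)).mpr
      (by exact_mod_cast hlt.le)))
    (fun n hn => Real.log_nonpos (by positivity) ((div_le_one (hz.trans_le (by exact_mod_cast hn))).mpr
      (by exact_mod_cast hn)))
  have e : ∑ p ∈ S, Real.log (z / p) = S.card * Real.log z - ∑ p ∈ S, Real.log p := by
    rw [← nsmul_eq_mul, ← Finset.sum_const, ← Finset.sum_sub_distrib]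
    refine Finset.sum_congr rfl fun p hp => ?_
    rw [Real.log_div hz.ne' (by exact_mod_cast (hS p hp).ne_zero)]
  rw [← le_div_iff₀ (by positivity)] at h5
  linarith

/-! ### Numerical values of logarithms -/

theorem Real.log_two_gt_d13 : 0.6931471805599 < Real.log 2 := by
  have h := Real.abs_log_sub_add_sum_range_le (x := 1 / 2) (by norm_num [abs_lt]) 45
  rw [show (1 - 1 / 2 : ℝ) = 2⁻¹ by norm_num, Real.log_inv,
    abs_of_pos (by norm_num : (0 : ℝ) < 1 / 2)] at h
  have h1 := (abs_le.mp h).2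
  norm_num [Finset.sum_range_succ] at h1
  linarith

theorem Real.log_ten_gt_d12 : 2.302585092993 < Real.log 10 := by
  have h := Real.abs_log_sub_add_sum_range_le (x := 1 / 5) (by norm_num [abs_lt]) 20
  have e : Real.log 10 = 3 * Real.log 2 + Real.log (5 / 4) := by
    rw [show (10 : ℝ) = 2 ^ 3 * (5 / 4) by norm_num, Real.log_mul (by norm_num) (by norm_num),
      Real.log_pow]
    norm_num
  rw [show (1 - 1 / 5 : ℝ) = (5 / 4)⁻¹ by norm_num, Real.log_inv,
    abs_of_pos (by norm_num : (0 : ℝ) < 1 / 5)] at h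
  have h1 := (abs_le.mp h).2
  have h2 := Real.log_two_gt_d13
  norm_num [Finset.sum_range_succ] at h1
  linarith

theorem log_85862401_gt : 8 * Real.log 10 - 0.1524241595 < Real.log 85862401 := by
  have h := Real.abs_log_sub_add_sum_range_le (x := 0.14137599) (by norm_num [abs_lt]) 14
  have e : Real.log 85862401 = 8 * Real.log 10 + Real.log (1 - 0.14137599) := by
    rw [show (85862401 : ℝ) = 10 ^ 8 * (1 - 0.14137599) by norm_num,
      Real.log_mul (by norm_num) (by norm_num), Real.log_pow]
    norm_num
  rw [abs_of_pos (by norm_num : (0 : ℝ) < 0.14137599)] at h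
  have h1 := (abs_le.mp h).1
  rw [e]
  norm_num [Finset.sum_range_succ] at h1 ⊢
  linarith

theorem four_mul_log_sub_log_three_lt : 4 * Real.log 1.485 - Real.log 3 < 0.48305 := by
  have h := Real.abs_log_sub_add_sum_range_le (x := 0.3831) (by norm_num [abs_lt]) 14
  have e : 4 * Real.log 1.485 - Real.log 3 = Real.log (1.485 ^ 4 / 3) := by
    rw [Real.log_div (by norm_num) (by norm_num), Real.log_pow]
    norm_num
  have e2 : Real.log (1.485 ^ 4 / 3) ≤ Real.log (1 - 0.3831)⁻¹ :=
    Real.log_le_log (by norm_num) (by norm_num)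
  rw [Real.log_inv] at e2
  rw [abs_of_pos (by norm_num : (0 : ℝ) < 0.3831)] at h
  have h1 := (abs_le.mp h).1
  rw [e]
  norm_num [Finset.sum_range_succ] at h1 e2 ⊢
  linarith

/-! ### Power sums modulo primes and prime powers -/

theorem sum_zmod_pow (p : ℕ) [Fact p.Prime] {k : ℕ} (hk : k ≠ 0) :
    ∑ x : ZMod p, x ^ k = if p - 1 ∣ k then -1 else 0 := by
  classical
  have h := FiniteField.sum_pow_units (ZMod p) k
  rw [ZMod.card] at h
  rw [← h, ← Fintype.sum_subtype_add_sum_subtype (fun x : ZMod p => x = 0)]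
  refine Eq.trans (congrArg (· + _) (Finset.sum_eq_zero fun x _ => by rw [x.2, zero_pow hk])) ?_
  rw [zero_add]
  exact (Fintype.sum_equiv unitsEquivNeZero _ _ fun u => rfl).symm

theorem sum_range_pow_zmod (p : ℕ) [Fact p.Prime] {k : ℕ} (hk : k ≠ 0) (a : ℕ) :
    ∑ j ∈ Finset.range (p * a), (j : ZMod p) ^ k = if p - 1 ∣ k then -(a : ZMod p) else 0 := by
  have h1 : ∑ j ∈ Finset.range p, (j : ZMod p) ^ k = if p - 1 ∣ k then -1 else 0 := by
    rw [← sum_zmod_pow p hk]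
    refine Finset.sum_bij' (fun j _ => (j : ZMod p)) (fun x _ => x.val) (by simp)
      (fun x _ => by simp [ZMod.val_lt]) (fun j hj => ?_) (fun x _ => by simp) (by simp)
    exact ZMod.val_cast_of_lt (Finset.mem_range.mp hj)
  induction a with
  | zero => simp
  | succ a ih =>
    rw [Nat.mul_succ, Finset.sum_range_add, ih]
    have : ∀ j, ((p * a + j : ℕ) : ZMod p) = j := fun j => by simp
    simp only [this, h1]
    split <;> simp; ring

/-- The power sum over `p^(e+1)` terms is `p` times the power sum over `p^e` terms, modulo
`p^(e+1)`: write the terms as `j + i p^e`, expand to first order in `p^e`, and use that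
`k ∑_{i<p} i = (k/2) p (p - 1)` is divisible by `p`. -/
theorem sum_range_pow_modEq (p k e : ℕ) (hk : Even k) (he : 1 ≤ e) :
    ∑ j ∈ Finset.range (p ^ (e + 1)), (j : ℤ) ^ k ≡
      p * ∑ j ∈ Finset.range (p ^ e), (j : ℤ) ^ k [ZMOD (p : ℤ) ^ (e + 1)] := by
  have hterm : ∀ i j : ℕ, ((p ^ e * i + j : ℕ) : ℤ) ^ k ≡
      (j : ℤ) ^ k + k * j ^ (k - 1) * (p ^ e * i) [ZMOD (p : ℤ) ^ (e + 1)] := by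
    intro i j
    obtain ⟨c, hc⟩ := Polynomial.powAddExpansion (j : ℤ) ((p : ℤ) ^ e * i) k
    have : (p : ℤ) ^ (e + 1) ∣ (p : ℤ) ^ (e + e) := pow_dvd_pow _ (by omega)
    push_cast
    rw [add_comm ((p : ℤ) ^ e * i), hc]
    refine (Int.modEq_iff_dvd.mpr ?_)
    have e1 : (j : ℤ) ^ k + k * j ^ (k - 1) * (p ^ e * i) -
        (j ^ k + k * j ^ (k - 1) * (p ^ e * i) + c * (p ^ e * i) ^ 2) =
        (p : ℤ) ^ (e + e) * (- c * i ^ 2) := by ring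
    rw [e1]
    exact this.mul_right _
  have hblock : ∀ n : ℕ, ∑ j ∈ Finset.range (p ^ e * n), (j : ℤ) ^ k ≡
      n * ∑ j ∈ Finset.range (p ^ e), (j : ℤ) ^ k + (∑ i ∈ Finset.range n, (i : ℤ)) *
        (k * p ^ e * ∑ j ∈ Finset.range (p ^ e), (j : ℤ) ^ (k - 1)) [ZMOD (p : ℤ) ^ (e + 1)] := by
    intro n
    induction n with
    | zero => simp
    | succ n ih =>
      rw [Nat.mul_succ, Finset.sum_range_add, Finset.sum_range_succ _ n]
      have h2 : ∑ j ∈ Finset.range (p ^ e), ((p ^ e * n + j : ℕ) : ℤ) ^ k ≡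
          ∑ j ∈ Finset.range (p ^ e), ((j : ℤ) ^ k + k * j ^ (k - 1) * (p ^ e * n))
          [ZMOD (p : ℤ) ^ (e + 1)] := Int.ModEq.sum fun j _ => hterm n j
      refine (ih.add h2).trans ?_
      rw [Finset.sum_add_distrib, ← Finset.sum_mul, ← Finset.mul_sum]
      push_cast
      unfold Int.ModEq
      congr 1
      ring
  obtain ⟨l, rfl⟩ := hk
  have h3 := hblock p
  rw [← pow_succ] at h3
  refine h3.trans (Int.modEq_iff_dvd.mpr ?_)
  have h4 : (∑ i ∈ Finset.range p, (i : ℤ)) * 2 = p * ((p - 1 : ℕ) : ℤ) := by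
    rw [← Nat.cast_mul, ← Finset.sum_range_id_mul_two p]
    push_cast
    rfl
  refine ⟨-(((p - 1 : ℕ) : ℤ) * l * ∑ j ∈ Finset.range (p ^ e), (j : ℤ) ^ (l + l - 1)), ?_⟩
  rw [sub_add_cancel_left, pow_succ]
  push_cast
  linear_combination (-(l : ℤ) * p ^ e * ∑ j ∈ Finset.range (p ^ e), (j : ℤ) ^ (l + l - 1)) * h4

theorem sum_range_pow_mul_modEq (n u k : ℕ) :
    ∑ j ∈ Finset.range (n * u), (j : ℤ) ^ k ≡
      u * ∑ j ∈ Finset.range n, (j : ℤ) ^ k [ZMOD n] := by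
  induction u with
  | zero => simp
  | succ u ih =>
    rw [Nat.mul_succ, Finset.sum_range_add]
    have : ∑ j ∈ Finset.range n, ((n * u + j : ℕ) : ℤ) ^ k ≡ ∑ j ∈ Finset.range n, (j : ℤ) ^ k
        [ZMOD n] := Int.ModEq.sum fun j _ => Int.ModEq.pow _ (by
          push_cast
          exact Int.modEq_iff_dvd.mpr ⟨-u, by ring⟩)
    refine (ih.add this).trans ?_
    unfold Int.ModEq
    congr 1
    push_cast
    ring

/-- If `p - 1` divides the even number `k` and `p^e u` with `p ∤ u` is the number of terms, then the
power sum has `p`-adic valuation `e - 1`. -/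
theorem not_pow_dvd_sum_range_pow {p k : ℕ} (hp : p.Prime) (hk0 : k ≠ 0) (hk : Even k)
    (hpk : p - 1 ∣ k) {e u : ℕ} (he : 1 ≤ e) (hu : ¬ p ∣ u) :
    ¬ (p : ℤ) ^ e ∣ ∑ j ∈ Finset.range (p ^ e * u), (j : ℤ) ^ k := by
  have : Fact p.Prime := ⟨hp⟩
  have hS : ∑ j ∈ Finset.range (p ^ e), (j : ℤ) ^ k ≡ - p ^ (e - 1) [ZMOD (p : ℤ) ^ e] := by
    induction e, he using Nat.le_induction with
    | base =>
      have := sum_range_pow_zmod p hk0 1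
      rw [if_pos hpk] at this
      rw [pow_one, pow_one, ← ZMod.intCast_eq_intCast_iff]
      push_cast
      simpa using this
    | succ e he ih =>
      refine (sum_range_pow_modEq p k e hk he).trans ?_
      have h2 := ih.mul_left' (c := (p : ℤ))
      rw [← pow_succ'] at h2
      refine h2.trans ?_
      unfold Int.ModEq
      congr 1
      obtain ⟨d, rfl⟩ := Nat.exists_eq_add_of_le' he
      simp only [Nat.add_sub_cancel]
      ring
  intro hdvd
  have h1 := sum_range_pow_mul_modEq (p ^ e) u k
  push_cast at h1
  have h2 := (h1.trans (hS.mul_left u)).dvd_iff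
  rw [h2] at hdvd
  obtain ⟨d, rfl⟩ := Nat.exists_eq_add_of_le' he
  simp only [Nat.add_sub_cancel, mul_neg, dvd_neg, pow_succ'] at hdvd
  have h3 : (p : ℤ) ∣ u := by
    have hp0 : ((p : ℤ) ^ d) ≠ 0 := pow_ne_zero _ (by exact_mod_cast hp.ne_zero)
    exact Int.dvd_of_mul_dvd_mul_right hp0 hdvd
  exact hu (by exact_mod_cast h3)

/-! ### Reciprocal sums over prime factors -/

/-- The sum of the reciprocals of the prime factors of `n`. -/
noncomputable def primeRecipSum (n : ℕ) : ℝ := ∑ p ∈ n.primeFactors, (1 / p : ℝ)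

theorem primeRecipSum_mul {a b : ℕ} (h : a.Coprime b) :
    primeRecipSum (a * b) = primeRecipSum a + primeRecipSum b := by
  rw [primeRecipSum, h.primeFactors_mul, Finset.sum_union h.disjoint_primeFactors]
  rfl

theorem primeRecipSum_prime {p : ℕ} (hp : p.Prime) : primeRecipSum p = 1 / p := by
  simp [primeRecipSum, hp.primeFactors]

theorem squarefree_of_dvd_div_add {n c : ℕ}
    (h : ∀ p, p.Prime → p ∣ n → p ∣ n / p + c ∧ ¬ p ∣ c) : Squarefree n := by
  rw [Nat.squarefree_iff_prime_squarefree]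
  intro p hp hpp
  have hpn : p ∣ n := (dvd_mul_right p p).trans hpp
  obtain ⟨h1, h2⟩ := h p hp hpn
  obtain ⟨d, rfl⟩ := hpp
  rw [mul_assoc, Nat.mul_div_cancel_left _ hp.pos] at h1
  exact h2 ((Nat.dvd_add_right (dvd_mul_right p d)).mp h1)

/-- Moser's congruence: under the hypothesis, the positive rational number
`∑_{p ∣ n} 1/p + c/n` is an integer. -/
theorem one_sub_le_primeRecipSum {n c : ℕ} (hn : 0 < n) (hc : 0 < c)
    (h : ∀ p, p.Prime → p ∣ n → p ∣ n / p + c ∧ ¬ p ∣ c) :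
    1 - (c : ℝ) / n ≤ primeRecipSum n := by
  have hsq := squarefree_of_dvd_div_add h
  have hdvd : n ∣ ∑ p ∈ n.primeFactors, n / p + c := by
    conv_lhs => rw [← Nat.prod_primeFactors_of_squarefree hsq]
    refine Finset.prod_primes_dvd _ (fun p hp => (Nat.prime_of_mem_primeFactors hp).prime)
      fun p hp => ?_
    have hpp := Nat.prime_of_mem_primeFactors hp
    rw [← Finset.add_sum_erase _ _ hp, add_right_comm]
    refine dvd_add (h p hpp (Nat.dvd_of_mem_primeFactors hp)).1 (Finset.dvd_sum fun q hq => ?_)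
    rw [Finset.mem_erase] at hq
    have hqp := Nat.prime_of_mem_primeFactors hq.2
    have hqn := Nat.dvd_of_mem_primeFactors hq.2
    have hmul : p ∣ q * (n / q) := by
      rw [Nat.mul_div_cancel' hqn]
      exact Nat.dvd_of_mem_primeFactors hp
    rcases (Nat.Prime.dvd_mul hpp).mp hmul with h1 | h1
    · exact absurd ((Nat.prime_dvd_prime_iff_eq hpp hqp).mp h1).symm hq.1
    · exact h1
  have hle : n ≤ ∑ p ∈ n.primeFactors, n / p + c := Nat.le_of_dvd (by omega) hdvd
  have hnR : (0 : ℝ) < n := by exact_mod_cast hn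
  have hsum : ((∑ p ∈ n.primeFactors, n / p : ℕ) : ℝ) = n * primeRecipSum n := by
    rw [primeRecipSum, Finset.mul_sum, Nat.cast_sum]
    refine Finset.sum_congr rfl fun p hp => ?_
    rw [Nat.cast_div (Nat.dvd_of_mem_primeFactors hp)
      (by exact_mod_cast (Nat.prime_of_mem_primeFactors hp).ne_zero)]
    ring
  have h2 : (n : ℝ) ≤ n * primeRecipSum n + c := by rw [← hsum]; exact_mod_cast hle
  rw [sub_le_iff_le_add, ← mul_le_mul_iff_right₀ hnR]
  have : (n : ℝ) * (c / n) = c := by field_simp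
  linarith

/-! ### Local consequences of the equation -/

/-- The common core of the four congruences: a sum of `p a` consecutive powers is `-a` or `0` modulo
`p`, according to whether `p - 1` divides `k`; if it is congruent to the nonzero value `c m^k`, then
`p - 1` divides `k`, so that `m^k = 1` by Fermat's theorem. -/
theorem dvd_div_add_of_sum_eq {p : ℕ} [Fact p.Prime] {k m a c : ℕ} (hk : k ≠ 0) (hc : ¬ p ∣ c)
    (hm : ¬ p ∣ m)
    (h : ∑ j ∈ Finset.range (p * a), (j : ZMod p) ^ k = c * (m : ZMod p) ^ k) :
    p - 1 ∣ k ∧ p ∣ a + c := by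
  have hm' : (m : ZMod p) ≠ 0 := by rwa [Ne, ZMod.natCast_eq_zero_iff]
  have hc' : (c : ZMod p) ≠ 0 := by rwa [Ne, ZMod.natCast_eq_zero_iff]
  rw [sum_range_pow_zmod p hk a] at h
  by_cases hpk : p - 1 ∣ k
  · refine ⟨hpk, ?_⟩
    obtain ⟨t, rfl⟩ := hpk
    rw [if_pos (dvd_mul_right _ _), pow_mul, ZMod.pow_card_sub_one_eq_one hm', one_pow, mul_one] at h
    rw [← ZMod.natCast_eq_zero_iff, Nat.cast_add, ← h]
    ring
  · rw [if_neg hpk] at h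
    exact absurd h.symm (mul_ne_zero hc' (pow_ne_zero k hm'))

/-- For even `k`, the symmetry `j ↦ 2 n + 1 - j` of the nonzero terms folds the power sum modulo a
divisor of `2 n + 1`. -/
theorem sum_range_pow_zmod_reflect {p k : ℕ} (n : ℕ) (hk : Even k) (hk0 : k ≠ 0)
    (hn : p ∣ 2 * n + 1) :
    ∑ j ∈ Finset.range (2 * n + 1), (j : ZMod p) ^ k =
      2 * ∑ j ∈ Finset.range (n + 1), (j : ZMod p) ^ k := by
  have h0 : (2 * n + 1 : ZMod p) = 0 := by exact_mod_cast (ZMod.natCast_eq_zero_iff _ _).mpr hn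
  have h1 : ∑ i ∈ Finset.range n, ((n + 1 + i : ℕ) : ZMod p) ^ k =
      ∑ i ∈ Finset.range n, ((i + 1 : ℕ) : ZMod p) ^ k := by
    rw [← Finset.sum_range_reflect]
    refine Finset.sum_congr rfl fun i hi => ?_
    have hi' := Finset.mem_range.mp hi
    rw [← hk.neg_pow]
    congr 1
    have : ((n + 1 + (n - 1 - i) : ℕ) : ZMod p) + ((i + 1 : ℕ) : ZMod p) = 0 := by
      rw [← Nat.cast_add, show n + 1 + (n - 1 - i) + (i + 1) = 2 * n + 1 by omega]
      exact_mod_cast h0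
    linear_combination -this
  rw [show 2 * n + 1 = (n + 1) + n by ring, Finset.sum_range_add, h1, two_mul]
  congr 1
  rw [Finset.sum_range_succ']
  simp [hk0]

theorem sum_range_pow_modEq_four {k : ℕ} (hk : Even k) (hk0 : k ≠ 0) (r : ℕ) :
    ∑ j ∈ Finset.range (2 * r + 1), j ^ k ≡ r [MOD 4] := by
  obtain ⟨l, rfl⟩ := hk
  have hl : l ≠ 0 := by omega
  have hodd : ∀ i, (2 * i + 1) ^ (l + l) ≡ 1 [MOD 4] := by
    intro i
    rw [← two_mul, pow_mul]
    have : (2 * i + 1) ^ 2 ≡ 1 [MOD 4] := by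
      rw [show (2 * i + 1) ^ 2 = 1 + 4 * (i * i + i) by ring]
      simp [Nat.ModEq]
    simpa using this.pow l
  have heven : ∀ i, (2 * i + 2) ^ (l + l) ≡ 0 [MOD 4] := by
    intro i
    rw [← two_mul, pow_mul]
    have : (2 * i + 2) ^ 2 ≡ 0 [MOD 4] := by
      rw [show (2 * i + 2) ^ 2 = 4 * ((i + 1) ^ 2) by ring]
      simp [Nat.ModEq]
    simpa [hl] using this.pow l
  induction r with
  | zero => simp [hl, Nat.ModEq]
  | succ r ih =>
    rw [show 2 * (r + 1) + 1 = 2 * r + 1 + 1 + 1 by ring, Finset.sum_range_succ,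
      Finset.sum_range_succ]
    exact (ih.add (hodd r)).add (heven r)

/-- A solution of the Erdős–Moser equation, apart from the trivial solution `1 + 2 = 3`. -/
structure ErdosMoser (m k : ℕ) : Prop where
  one_le : 1 ≤ m
  two_le : 2 ≤ k
  sum_eq : ∑ j ∈ Finset.range m, j ^ k = m ^ k

namespace ErdosMoser

variable {m k : ℕ}

theorem k_ne_zero (h : ErdosMoser m k) : k ≠ 0 := by have := h.two_le; omega

theorem four_le (h : ErdosMoser m k) : 4 ≤ m := by
  obtain ⟨l, rfl⟩ := Nat.exists_eq_add_of_le' h.two_le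
  have hs := h.sum_eq
  by_contra hm
  have h1 : 2 ^ l ≤ 3 ^ l := Nat.pow_le_pow_left (by norm_num) l
  have h2 : 1 ≤ 2 ^ l := Nat.one_le_two_pow
  have h0 := h.one_le
  have h3 : m < 4 := by omega
  interval_cases m <;> simp [Finset.sum_range_succ, pow_add] at hs <;> omega

theorem sum_zmod_eq (h : ErdosMoser m k) (p : ℕ) :
    ∑ j ∈ Finset.range m, (j : ZMod p) ^ k = (m : ZMod p) ^ k := by
  exact_mod_cast congrArg (Nat.cast : ℕ → ZMod p) h.sum_eq

theorem dvd_sub_one (h : ErdosMoser m k) {p : ℕ} (hp : p.Prime) (hpm : p ∣ m - 1) :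
    p - 1 ∣ k ∧ p ∣ (m - 1) / p + 1 := by
  have : Fact p.Prime := ⟨hp⟩
  have hm := h.four_le
  obtain ⟨a, ha⟩ := hpm
  rw [ha, Nat.mul_div_cancel_left _ hp.pos]
  have hpm : ¬ p ∣ m := fun hdvd => hp.not_dvd_one
    ((Nat.dvd_add_right (Dvd.intro a rfl)).mp
      (show p ∣ p * a + 1 by rwa [← ha, Nat.sub_add_cancel (by omega)]))
  refine dvd_div_add_of_sum_eq (m := m) h.k_ne_zero hp.not_dvd_one hpm ?_
  have h1 := h.sum_zmod_eq p
  rw [show m = p * a + 1 by omega, Finset.sum_range_succ] at h1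
  rw [show m = p * a + 1 by omega, ← h1]
  simp [h.k_ne_zero]

theorem squarefree_sub_one (h : ErdosMoser m k) : Squarefree (m - 1) :=
  squarefree_of_dvd_div_add fun _ hp hpm => ⟨(h.dvd_sub_one hp hpm).2, hp.not_dvd_one⟩

/-- The squarefree integer `m - 1 ≥ 3` has an odd prime factor `p`, and `p - 1` divides `k`. -/
theorem even_k (h : ErdosMoser m k) : Even k := by
  by_contra hk
  have hall : ∀ p, p.Prime → p ∣ m - 1 → p = 2 := by
    intro p hp hpm
    by_contra hp2
    have h1 := (hp.even_sub_one hp2).two_dvd.trans (h.dvd_sub_one hp hpm).1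
    exact hk (even_iff_two_dvd.mpr h1)
  have hm := h.four_le
  have h1 := Nat.prod_primeFactors_of_squarefree h.squarefree_sub_one
  have h2 : (m - 1).primeFactors ⊆ {2} := fun p hp => Finset.mem_singleton.mpr
    (hall p (Nat.prime_of_mem_primeFactors hp) (Nat.dvd_of_mem_primeFactors hp))
  rcases Finset.subset_singleton_iff.mp h2 with h3 | h3 <;> rw [h3] at h1 <;> simp at h1 <;> omega

/-- If `p ∣ m` and `p^e` is the exact power of `p` in `m`, then `p^e` divides `m^k` but not the power
sum. -/
theorem not_dvd_of_sub_one_dvd (h : ErdosMoser m k) {p : ℕ} (hp : p.Prime) (hpk : p - 1 ∣ k) :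
    ¬ p ∣ m := by
  intro hpm
  have hm := h.four_le
  obtain ⟨e, u, hu, hmu⟩ := Nat.exists_eq_pow_mul_and_not_dvd (show m ≠ 0 by omega) p hp.ne_one
  have he : 1 ≤ e := by
    by_contra he
    obtain rfl : e = 0 := by omega
    rw [pow_zero, one_mul] at hmu
    exact hu (hmu ▸ hpm)
  refine not_pow_dvd_sum_range_pow hp h.k_ne_zero h.even_k hpk he hu ?_
  rw [← hmu]
  have h1 : (∑ j ∈ Finset.range m, (j : ℤ) ^ k) = (m : ℤ) ^ k := by
    exact_mod_cast congrArg (Nat.cast : ℕ → ℤ) h.sum_eq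
  rw [h1]
  refine dvd_pow ?_ h.k_ne_zero
  rw [hmu]
  push_cast
  exact dvd_mul_right _ _

theorem not_two_dvd (h : ErdosMoser m k) : ¬ 2 ∣ m :=
  h.not_dvd_of_sub_one_dvd Nat.prime_two (one_dvd k)

theorem not_three_dvd (h : ErdosMoser m k) : ¬ 3 ∣ m :=
  h.not_dvd_of_sub_one_dvd Nat.prime_three h.even_k.two_dvd

theorem mod_eight (h : ErdosMoser m k) : m % 8 = 3 := by
  obtain ⟨r, hr⟩ : Odd m := by rw [← Nat.not_even_iff_odd, even_iff_two_dvd]; exact h.not_two_dvd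
  have h1 := sum_range_pow_modEq_four h.even_k h.k_ne_zero r
  rw [← hr, h.sum_eq] at h1
  obtain ⟨l, rfl⟩ := h.even_k
  have h2 : m ^ (l + l) ≡ 1 [MOD 4] := by
    rw [← two_mul, pow_mul]
    have : m ^ 2 ≡ 1 [MOD 4] := by
      rw [hr, show (2 * r + 1) ^ 2 = 1 + 4 * (r * r + r) by ring]
      simp [Nat.ModEq]
    simpa using this.pow l
  have h3 := h1.symm.trans h2
  unfold Nat.ModEq at h3
  omega

theorem dvd_add_one (h : ErdosMoser m k) {p : ℕ} (hp : p.Prime) (hp2 : p ≠ 2) (hpm : p ∣ m + 1) :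
    p - 1 ∣ k ∧ p ∣ (m + 1) / p + 2 := by
  have : Fact p.Prime := ⟨hp⟩
  obtain ⟨a, ha⟩ := hpm
  rw [ha, Nat.mul_div_cancel_left _ hp.pos]
  have hpm : ¬ p ∣ m := fun hdvd => hp.not_dvd_one
    ((Nat.dvd_add_right hdvd).mp (show p ∣ m + 1 from ⟨a, ha⟩))
  refine dvd_div_add_of_sum_eq (m := m) h.k_ne_zero
    (fun hd => hp2 ((Nat.prime_dvd_prime_iff_eq hp Nat.prime_two).mp hd)) hpm ?_
  rw [← ha, Finset.sum_range_succ, h.sum_zmod_eq p]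
  push_cast
  ring

theorem dvd_two_mul_sub_one (h : ErdosMoser m k) {p : ℕ} (hp : p.Prime) (hpm : p ∣ 2 * m - 1) :
    p - 1 ∣ k ∧ p ∣ (2 * m - 1) / p + 2 ∧ ¬ p ∣ 2 := by
  have : Fact p.Prime := ⟨hp⟩
  have hm := h.four_le
  have hp2 : ¬ p ∣ 2 := by
    intro hd
    rw [(Nat.prime_dvd_prime_iff_eq hp Nat.prime_two).mp hd] at hpm
    omega
  have hpm' : ¬ p ∣ m := fun hdvd => hp.not_dvd_one (by
    have := Nat.dvd_sub (hdvd.mul_left 2) hpm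
    rwa [show 2 * m - (2 * m - 1) = 1 by omega] at this)
  have hrefl := sum_range_pow_zmod_reflect (m - 1) h.even_k h.k_ne_zero
    (show p ∣ 2 * (m - 1) + 1 by rwa [show 2 * (m - 1) + 1 = 2 * m - 1 by omega])
  rw [show 2 * (m - 1) + 1 = 2 * m - 1 by omega, show m - 1 + 1 = m by omega,
    h.sum_zmod_eq p] at hrefl
  obtain ⟨a, ha⟩ := hpm
  rw [ha, Nat.mul_div_cancel_left _ hp.pos]
  rw [ha] at hrefl
  have := dvd_div_add_of_sum_eq (c := 2) h.k_ne_zero hp2 hpm' (by exact_mod_cast hrefl)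
  exact ⟨this.1, this.2, hp2⟩

theorem dvd_two_mul_add_one (h : ErdosMoser m k) {p : ℕ} (hp : p.Prime) (hpm : p ∣ 2 * m + 1) :
    p - 1 ∣ k ∧ p ∣ (2 * m + 1) / p + 4 ∧ ¬ p ∣ 4 := by
  have : Fact p.Prime := ⟨hp⟩
  have hp4 : ¬ p ∣ 4 := by
    intro hd
    rw [(Nat.prime_dvd_prime_iff_eq hp Nat.prime_two).mp
      (hp.dvd_of_dvd_pow (show p ∣ 2 ^ 2 from hd))] at hpm
    omega
  have hpm' : ¬ p ∣ m := fun hdvd => hp.not_dvd_one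
    ((Nat.dvd_add_right (hdvd.mul_left 2)).mp hpm)
  have hrefl := sum_range_pow_zmod_reflect m h.even_k h.k_ne_zero hpm
  rw [Finset.sum_range_succ _ m, h.sum_zmod_eq p] at hrefl
  obtain ⟨a, ha⟩ := hpm
  rw [ha, Nat.mul_div_cancel_left _ hp.pos]
  rw [ha] at hrefl
  have := dvd_div_add_of_sum_eq (c := 4) h.k_ne_zero hp4 hpm' (by rw [hrefl]; push_cast; ring)
  exact ⟨this.1, this.2, hp4⟩

/-- The congruence for `m + 1`, divided by `2`. At `p = 2` it holds because `(m + 1) / 2` is twice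
an odd number. -/
theorem dvd_half_add_one (h : ErdosMoser m k) {p : ℕ} (hp : p.Prime) (hpm : p ∣ (m + 1) / 2) :
    p - 1 ∣ k ∧ p ∣ (m + 1) / 2 / p + 1 := by
  have h8 := h.mod_eight
  rcases eq_or_ne p 2 with rfl | hp2
  · exact ⟨one_dvd k, by omega⟩
  · obtain ⟨a, ha⟩ := hpm
    have hma : m + 1 = p * (2 * a) := by rw [mul_left_comm, ← ha]; omega
    obtain ⟨h1, h2⟩ := h.dvd_add_one hp hp2 ⟨_, hma⟩
    refine ⟨h1, ?_⟩
    rw [ha, Nat.mul_div_cancel_left _ hp.pos]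
    rw [hma, Nat.mul_div_cancel_left _ hp.pos, show 2 * a + 2 = 2 * (a + 1) by ring,
      hp.dvd_mul] at h2
    exact h2.resolve_left fun hd => hp2 ((Nat.prime_dvd_prime_iff_eq hp Nat.prime_two).mp hd)

theorem squarefree_half_add_one (h : ErdosMoser m k) : Squarefree ((m + 1) / 2) :=
  squarefree_of_dvd_div_add fun _ hp hpm => ⟨(h.dvd_half_add_one hp hpm).2, hp.not_dvd_one⟩

theorem squarefree_two_mul_sub_one (h : ErdosMoser m k) : Squarefree (2 * m - 1) :=
  squarefree_of_dvd_div_add fun _ hp hpm => (h.dvd_two_mul_sub_one hp hpm).2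

theorem squarefree_two_mul_add_one (h : ErdosMoser m k) : Squarefree (2 * m + 1) :=
  squarefree_of_dvd_div_add fun _ hp hpm => (h.dvd_two_mul_add_one hp hpm).2

/-! ### The product of the four integers -/

/-- The four reciprocal sums add up to almost `4`. -/
theorem four_sub_le (h : ErdosMoser m k) :
    4 - 6 / ((m : ℝ) - 1) ≤ primeRecipSum (m - 1) + primeRecipSum ((m + 1) / 2) +
      primeRecipSum (2 * m - 1) + primeRecipSum (2 * m + 1) := by
  have hm := h.four_le
  have h8 := h.mod_eight
  have h1 := one_sub_le_primeRecipSum (n := m - 1) (by omega) one_pos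
    fun p hp hpm => ⟨(h.dvd_sub_one hp hpm).2, hp.not_dvd_one⟩
  have h2 := one_sub_le_primeRecipSum (n := (m + 1) / 2) (by omega) one_pos
    fun p hp hpm => ⟨(h.dvd_half_add_one hp hpm).2, hp.not_dvd_one⟩
  have h3 := one_sub_le_primeRecipSum (n := 2 * m - 1) (by omega) two_pos
    fun p hp hpm => (h.dvd_two_mul_sub_one hp hpm).2
  have h4 := one_sub_le_primeRecipSum (n := 2 * m + 1) (by omega) four_pos
    fun p hp hpm => (h.dvd_two_mul_add_one hp hpm).2
  obtain ⟨u, rfl⟩ : ∃ u, m = 8 * u + 3 := ⟨m / 8, by omega⟩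
  rw [show 8 * u + 3 - 1 = 8 * u + 2 by omega] at h1 ⊢
  rw [show (8 * u + 3 + 1) / 2 = 4 * u + 2 by omega] at h2 ⊢
  rw [show 2 * (8 * u + 3) - 1 = 16 * u + 5 by omega] at h3 ⊢
  rw [show 2 * (8 * u + 3) + 1 = 16 * u + 7 by omega] at h4 ⊢
  push_cast at h1 h2 h3 h4 ⊢
  have hu : (0 : ℝ) ≤ u := Nat.cast_nonneg u
  have e0 : 6 / (8 * (u : ℝ) + 3 - 1) = 6 * (1 / (8 * u + 2)) := by ring
  have e2 : 1 / (4 * (u : ℝ) + 2) ≤ 2 * (1 / (8 * u + 2)) := by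
    rw [mul_one_div, div_le_div_iff₀ (by positivity) (by positivity)]; linarith
  have e3 : 2 / (16 * (u : ℝ) + 5) ≤ 1 / (8 * u + 2) := by
    rw [div_le_div_iff₀ (by positivity) (by positivity)]; linarith
  have e4 : 4 / (16 * (u : ℝ) + 7) ≤ 2 * (1 / (8 * u + 2)) := by
    rw [mul_one_div, div_le_div_iff₀ (by positivity) (by positivity)]; linarith
  rw [e0]
  linarith

/-- Removing the common factors `2` (of `m - 1` and `m + 1`) and `3` (of one of `m ∓ 1` and one of
`2 m ± 1`) from the product of the four integers leaves four coprime squarefree factors. -/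
theorem exists_coprime_factors (h : ErdosMoser m k) : ∃ b c d : ℕ,
    (m ^ 2 - 1) * (4 * m ^ 2 - 1) = 12 * ((m - 1) * (b * (c * d))) ∧
    (m - 1).Coprime (b * (c * d)) ∧ b.Coprime (c * d) ∧ c.Coprime d ∧
    Squarefree b ∧ Squarefree c ∧ Squarefree d ∧
    primeRecipSum ((m + 1) / 2) = 1 / 2 + primeRecipSum b ∧
    primeRecipSum (2 * m - 1) + primeRecipSum (2 * m + 1) =
      1 / 3 + primeRecipSum c + primeRecipSum d := by
  have h8 := h.mod_eight
  have h3 := h.not_three_dvd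
  have s2 := h.squarefree_half_add_one
  have s3 := h.squarefree_two_mul_sub_one
  have s4 := h.squarefree_two_mul_add_one
  obtain ⟨u, rfl⟩ : ∃ u, m = 8 * u + 3 := ⟨m / 8, by omega⟩
  rw [show (8 * u + 3 + 1) / 2 = 2 * (2 * u + 1) by omega] at s2 ⊢
  rw [show 2 * (8 * u + 3) - 1 = 16 * u + 5 by omega] at s3 ⊢
  rw [show 2 * (8 * u + 3) + 1 = 16 * u + 7 by omega] at s4 ⊢
  rw [show 8 * u + 3 - 1 = 8 * u + 2 by omega]
  have hprod : ((8 * u + 3) ^ 2 - 1) * (4 * (8 * u + 3) ^ 2 - 1) =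
      4 * ((8 * u + 2) * ((2 * u + 1) * ((16 * u + 5) * (16 * u + 7)))) := by
    rw [show (8 * u + 3) ^ 2 - 1 = (8 * u + 2) * (8 * u + 4) from Nat.sub_eq_of_eq_add (by ring),
      show 4 * (8 * u + 3) ^ 2 - 1 = (16 * u + 5) * (16 * u + 7) from
        Nat.sub_eq_of_eq_add (by ring)]
    ring
  have hb : primeRecipSum (2 * (2 * u + 1)) = 1 / 2 + primeRecipSum (2 * u + 1) := by
    rw [primeRecipSum_mul ((Nat.coprime_two_left).mpr ⟨u, rfl⟩), primeRecipSum_prime Nat.prime_two]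
    norm_num
  have sb : Squarefree (2 * u + 1) := s2.squarefree_of_dvd (dvd_mul_left _ _)
  -- a common prime factor of two of the four integers divides one of these combinations
  have aux1 : ∀ p, p.Prime → p ∣ 8 * u + 2 → ¬ p ∣ 2 * u + 1 := fun p hp h1 h2 => by
    have := (Nat.dvd_sub (h2.mul_left 4) h1)
    rw [show 4 * (2 * u + 1) - (8 * u + 2) = 2 by omega,
      Nat.prime_dvd_prime_iff_eq hp Nat.prime_two] at this
    subst this
    omega
  have aux2 : ∀ p, p.Prime → p ∣ 8 * u + 2 → ¬ p ∣ 16 * u + 5 := fun p hp h1 h2 => by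
    have := (Nat.dvd_sub h2 (h1.mul_left 2))
    rw [show 16 * u + 5 - 2 * (8 * u + 2) = 1 by omega] at this
    exact hp.not_dvd_one this
  have aux3 : ∀ p, p.Prime → p ∣ 8 * u + 2 → p ∣ 16 * u + 7 → p = 3 := fun p hp h1 h2 => by
    have := (Nat.dvd_sub h2 (h1.mul_left 2))
    rwa [show 16 * u + 7 - 2 * (8 * u + 2) = 3 by omega,
      Nat.prime_dvd_prime_iff_eq hp Nat.prime_three] at this
  have aux4 : ∀ p, p.Prime → p ∣ 2 * u + 1 → p ∣ 16 * u + 5 → p = 3 := fun p hp h1 h2 => by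
    have := (Nat.dvd_sub (h1.mul_left 8) h2)
    rwa [show 8 * (2 * u + 1) - (16 * u + 5) = 3 by omega,
      Nat.prime_dvd_prime_iff_eq hp Nat.prime_three] at this
  have aux5 : ∀ p, p.Prime → p ∣ 2 * u + 1 → ¬ p ∣ 16 * u + 7 := fun p hp h1 h2 => by
    have := (Nat.dvd_sub (h1.mul_left 8) h2)
    rw [show 8 * (2 * u + 1) - (16 * u + 7) = 1 by omega] at this
    exact hp.not_dvd_one this
  have aux6 : ∀ p, p.Prime → p ∣ 16 * u + 5 → ¬ p ∣ 16 * u + 7 := fun p hp h1 h2 => by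
    have := (Nat.dvd_sub h2 h1)
    rw [show 16 * u + 7 - (16 * u + 5) = 2 by omega,
      Nat.prime_dvd_prime_iff_eq hp Nat.prime_two] at this
    subst this
    omega
  have hthree : ∀ d, Squarefree (3 * d) → ¬ 3 ∣ d ∧
      primeRecipSum (3 * d) = 1 / 3 + primeRecipSum d ∧ Squarefree d := fun d hd => by
    have hcop := Nat.coprime_of_squarefree_mul hd
    refine ⟨(Nat.Prime.coprime_iff_not_dvd Nat.prime_three).mp hcop, ?_,
      hd.squarefree_of_dvd (dvd_mul_left _ _)⟩
    rw [primeRecipSum_mul hcop, primeRecipSum_prime Nat.prime_three]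
    norm_num
  rcases (by omega : u % 3 = 2 ∨ u % 3 = 1) with hu | hu
  · obtain ⟨d, hd⟩ : 3 ∣ 16 * u + 7 := by omega
    have hdd : d ∣ 16 * u + 7 := ⟨3, by omega⟩
    rw [hd] at s4
    obtain ⟨t1, t2, t3⟩ := hthree d s4
    refine ⟨2 * u + 1, 16 * u + 5, d, ?_, ?_, ?_, ?_, sb, s3, t3, hb, ?_⟩
    · rw [hprod, hd]; ring
    · refine (Nat.coprime_of_dvd fun p hp => aux1 p hp).mul_right
        ((Nat.coprime_of_dvd fun p hp => aux2 p hp).mul_right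
        (Nat.coprime_of_dvd fun p hp h1 h2 => ?_))
      exact t1 (aux3 p hp h1 (h2.trans hdd) ▸ h2)
    · refine (Nat.coprime_of_dvd fun p hp h1 h2 => ?_).mul_right
        (Nat.coprime_of_dvd fun p hp h1 h2 => aux5 p hp h1 (h2.trans hdd))
      rw [aux4 p hp h1 h2] at h1
      omega
    · exact Nat.coprime_of_dvd fun p hp h1 h2 => aux6 p hp h1 (h2.trans hdd)
    · rw [hd, t2]; ring
  · obtain ⟨c, hc⟩ : 3 ∣ 16 * u + 5 := by omega
    have hcc : c ∣ 16 * u + 5 := ⟨3, by omega⟩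
    rw [hc] at s3
    obtain ⟨t1, t2, t3⟩ := hthree c s3
    refine ⟨2 * u + 1, c, 16 * u + 7, ?_, ?_, ?_, ?_, sb, t3, s4, hb, ?_⟩
    · rw [hprod, hc]; ring
    · refine (Nat.coprime_of_dvd fun p hp => aux1 p hp).mul_right
        ((Nat.coprime_of_dvd fun p hp h1 h2 => aux2 p hp h1 (h2.trans hcc)).mul_right
        (Nat.coprime_of_dvd fun p hp h1 h2 => ?_))
      rw [aux3 p hp h1 h2] at h1
      omega
    · refine (Nat.coprime_of_dvd fun p hp h1 h2 => ?_).mul_right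
        (Nat.coprime_of_dvd fun p hp => aux5 p hp)
      exact t1 (aux4 p hp h1 (h2.trans hcc) ▸ h2)
    · exact Nat.coprime_of_dvd fun p hp h1 h2 => aux6 p hp (h1.trans hcc) h2
    · rw [hc, t2]

/-- The reciprocal sum is `4 - 1/2 - 1/3` up to `O(1/m)`: in the sum over the four integers, the primes
`2` and `3` are counted twice, and the other primes at most once. -/
theorem twelve_dvd_and_squarefree (h : ErdosMoser m k) :
    12 ∣ (m ^ 2 - 1) * (4 * m ^ 2 - 1) ∧ Squarefree ((m ^ 2 - 1) * (4 * m ^ 2 - 1) / 12) ∧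
    19 / 6 - 6 / ((m : ℝ) - 1) ≤ primeRecipSum ((m ^ 2 - 1) * (4 * m ^ 2 - 1) / 12) := by
  obtain ⟨b, c, d, h1, h2, h3, h4, sb, sc, sd, r1, r2⟩ := h.exists_coprime_factors
  have h5 := h.four_sub_le
  refine ⟨⟨_, h1⟩, ?_⟩
  rw [h1, Nat.mul_div_cancel_left _ (by norm_num), Nat.squarefree_mul h2, Nat.squarefree_mul h3,
    Nat.squarefree_mul h4, primeRecipSum_mul h2, primeRecipSum_mul h3, primeRecipSum_mul h4]
  refine ⟨⟨h.squarefree_sub_one, sb, sc, sd⟩, ?_⟩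
  linarith

end ErdosMoser

/-! ### Counting the prime factors -/

namespace ErdosMoser

variable {m k : ℕ}

theorem three_mul_le_pow_four (h : ErdosMoser m k) :
    3 * ((m ^ 2 - 1) * (4 * m ^ 2 - 1) / 12) ≤ m ^ 4 := by
  have h1 := Nat.div_mul_cancel h.twelve_dvd_and_squarefree.1
  have h2 : (m ^ 2 - 1) * (4 * m ^ 2 - 1) ≤ m ^ 2 * (4 * m ^ 2) :=
    Nat.mul_le_mul (Nat.sub_le _ _) (Nat.sub_le _ _)
  have h3 : m ^ 2 * (4 * m ^ 2) = 4 * m ^ 4 := by ring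
  omega

/-- A crude first bound, which makes the error term `6 / (m - 1)` harmless: the reciprocal sum is at least
`19/6 - 6/10`, as `m ≥ 11`, and by the bounds at `129` this takes more than `119` primes, whose
product is at least `2^120`. -/
theorem two_pow_thirty_le (h : ErdosMoser m k) : 2 ^ 30 ≤ m := by
  obtain ⟨-, hsq, hsum⟩ := h.twelve_dvd_and_squarefree
  have hle := h.three_mul_le_pow_four
  set M := (m ^ 2 - 1) * (4 * m ^ 2 - 1) / 12
  have h4 := h.four_le
  have h8 := h.mod_eight
  have hm : (10 : ℝ) ≤ (m : ℝ) - 1 := by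
    have : (11 : ℝ) ≤ m := by exact_mod_cast (by omega : 11 ≤ m)
    linarith
  have hcard : 120 ≤ M.primeFactors.card := by
    by_contra hlt
    have h1 := primeBounds_129.sum_one_div_le (S := M.primeFactors)
      fun p hp => Nat.prime_of_mem_primeFactors hp
    have h2 : (M.primeFactors.card : ℝ) ≤ 119 := by exact_mod_cast (by omega)
    have h3 : 6 / ((m : ℝ) - 1) ≤ 6 / 10 := div_le_div_of_nonneg_left (by norm_num) (by norm_num) hm
    change _ ≤ ∑ p ∈ M.primeFactors, (1 / p : ℝ) at hsum
    norm_num at h1 hsum h3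
    linarith
  have hprod : 2 ^ M.primeFactors.card ≤ M := by
    conv_rhs => rw [← Nat.prod_primeFactors_of_squarefree hsq]
    rw [← Finset.prod_const]
    exact Finset.prod_le_prod' fun p hp => (Nat.prime_of_mem_primeFactors hp).two_le
  have h5 : 2 ^ 120 ≤ m ^ 4 := by
    have := Nat.pow_le_pow_right two_pos hcard
    omega
  rw [show (2 : ℕ) ^ 120 = (2 ^ 30) ^ 4 by norm_num] at h5
  exact (Nat.pow_le_pow_iff_left (by norm_num)).mp h5

/-- With `4990905` prime factors, the bounds at `85862401` would leave the reciprocal sum below `19/6` by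
more than `7 · 10⁻⁹`, which exceeds the error term `6 / (2^30 - 1)`. -/
theorem le_card_primeFactors (h : ErdosMoser m k) :
    4990906 ≤ ((m ^ 2 - 1) * (4 * m ^ 2 - 1) / 12).primeFactors.card := by
  obtain ⟨-, -, hsum⟩ := h.twelve_dvd_and_squarefree
  set M := (m ^ 2 - 1) * (4 * m ^ 2 - 1) / 12
  by_contra hlt
  have h1 := primeBounds_85862401.sum_one_div_le (S := M.primeFactors)
    fun p hp => Nat.prime_of_mem_primeFactors hp
  have h2 : (M.primeFactors.card : ℝ) ≤ 4990905 := by exact_mod_cast (by omega)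
  have hm : (2 ^ 30 - 1 : ℝ) ≤ (m : ℝ) - 1 := by
    have : (2 ^ 30 : ℝ) ≤ m := by exact_mod_cast h.two_pow_thirty_le
    linarith
  have h3 : 6 / ((m : ℝ) - 1) ≤ 6 / (2 ^ 30 - 1) :=
    div_le_div_of_nonneg_left (by norm_num) (by norm_num) hm
  change _ ≤ ∑ p ∈ M.primeFactors, (1 / p : ℝ) at hsum
  norm_num at h1 hsum h3
  linarith

/-- Compare the logarithm of `m⁴ / 3` with the sum of the logarithms of the prime factors. -/
theorem lt_m (h : ErdosMoser m k) : (1.485 : ℝ) * (10 : ℝ) ^ (9321155 : ℕ) < (m : ℝ) := by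
  have hcard := h.le_card_primeFactors
  obtain ⟨-, hsq, -⟩ := h.twelve_dvd_and_squarefree
  have hle := h.three_mul_le_pow_four
  set M := (m ^ 2 - 1) * (4 * m ^ 2 - 1) / 12
  have hm0 : (0 : ℝ) < m := by exact_mod_cast (by have := h.four_le; omega)
  have hM0 : (0 : ℝ) < M := by exact_mod_cast Nat.pos_of_ne_zero hsq.ne_zero
  have h1 := primeBounds_85862401.le_sum_log (S := M.primeFactors)
    fun p hp => Nat.prime_of_mem_primeFactors hp
  have h2 : ∑ p ∈ M.primeFactors, Real.log p = Real.log M := by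
    rw [← Real.log_prod fun p hp => by
      exact_mod_cast (Nat.prime_of_mem_primeFactors hp).ne_zero, ← Nat.cast_prod,
      Nat.prod_primeFactors_of_squarefree hsq]
  have h3 : Real.log 3 + Real.log M ≤ 4 * Real.log m := by
    rw [← Real.log_mul (by norm_num) hM0.ne',
      show 4 * Real.log (m : ℝ) = Real.log ((m : ℝ) ^ 4) by rw [Real.log_pow]; norm_num]
    exact Real.log_le_log (by positivity) (by exact_mod_cast hle)
  have h4 : (4990906 : ℝ) * Real.log 85862401 ≤ M.primeFactors.card * Real.log 85862401 :=
    mul_le_mul_of_nonneg_right (by exact_mod_cast hcard) (Real.log_nonneg (by norm_num))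
  by_contra hlt
  have h5 := Real.log_le_log hm0 (not_lt.mp hlt)
  rw [Real.log_mul (by norm_num) (pow_ne_zero _ (by norm_num)), Real.log_pow] at h5
  have h6 := log_85862401_gt
  have h7 := four_mul_log_sub_log_three_lt
  have h8 := Real.log_ten_gt_d12
  rw [h2] at h1
  push_cast at h1 h5
  norm_num at h1 h4 h5 h6 h7 h8
  linarith

end ErdosMoser

theorem theorem2 (m k : ℕ) (hm : 1 ≤ m) (hk : 2 ≤ k)
    (h : ∑ j ∈ Finset.Icc 1 (m - 1), j ^ k = m ^ k) :
    -- 1)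
    (1.485 : ℝ) * (10 : ℝ) ^ (9321155 : ℕ) < (m : ℝ) ∧
    -- 2)
    (Even k ∧ m ≡ 3 [MOD 8] ∧ ((m : ℤ) ≡ 1 [ZMOD 3] ∨ (m : ℤ) ≡ -1 [ZMOD 3])) ∧
    -- 3)
    (Squarefree (m - 1) ∧ Squarefree ((m + 1) / 2) ∧
      Squarefree (2 * m - 1) ∧ Squarefree (2 * m + 1)) ∧
    -- 4)
    (∀ p : ℕ, p.Prime →
      (p ∣ m - 1 ∨ p ∣ (m + 1) / 2 ∨ p ∣ 2 * m - 1 ∨ p ∣ 2 * m + 1) → (p - 1) ∣ k) ∧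
    -- 5)
    (12 ∣ (m ^ 2 - 1) * (4 * m ^ 2 - 1) ∧
      Squarefree ((m ^ 2 - 1) * (4 * m ^ 2 - 1) / 12) ∧
      4990906 ≤ ((m ^ 2 - 1) * (4 * m ^ 2 - 1) / 12).primeFactors.card) := by
  have hE : ErdosMoser m k := by
    refine ⟨hm, hk, ?_⟩
    rw [← h, ← Finset.sum_subset (s₁ := Finset.Icc 1 (m - 1)) (s₂ := Finset.range m)]
    · intro j hj
      rw [Finset.mem_Icc] at hj
      exact Finset.mem_range.mpr (by omega)
    · intro j hj hj'
      rw [Finset.mem_range] at hj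
      rw [Finset.mem_Icc] at hj'
      obtain rfl : j = 0 := by omega
      exact zero_pow (by omega)
  refine ⟨hE.lt_m, ⟨hE.even_k, hE.mod_eight, ?_⟩, ⟨hE.squarefree_sub_one,
    hE.squarefree_half_add_one, hE.squarefree_two_mul_sub_one, hE.squarefree_two_mul_add_one⟩, ?_,
    hE.twelve_dvd_and_squarefree.1, hE.twelve_dvd_and_squarefree.2.1, hE.le_card_primeFactors⟩
  · have := hE.not_three_dvd
    unfold Int.ModEq
    omega
  · rintro p hp (hpm | hpm | hpm | hpm)
    · exact (hE.dvd_sub_one hp hpm).1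
    · exact (hE.dvd_half_add_one hp hpm).1
    · exact (hE.dvd_two_mul_sub_one hp hpm).1
    · exact (hE.dvd_two_mul_add_one hp hpm).1
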